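/- Let $N$ be a von Neumann algebra acting on a complex Hilbert space $H$, and let $J$ be a norm closed two-sided ideal of $N$. Let $(\mathcal{A},H,\mathcal{D})$ be a von Neumann spectral triple relative to $(N,J)$. That is, $\mathcal{A}$ is a (not necessarily unital) complex $*$-algebra represented in $N$, and $\mathcal{D}$ is a self-adjoint operator on $H$ affiliated to $N$ such that, for all $a\in\mathcal{A}$: 1. $a$ maps $\mathrm{Dom}(\mathcal{D})$ into itself, and $[\mathcal{D},a]$ extends from $\mathrm{Dom}(\mathcal{D})$ to a bounded operator on $H$; 2. $a(\lambda-\mathcal{D})^{-1}\in J$ for all $\lambda\in\mathbb{C}\setminus\mathbb{R}$. Let $F_{\mathcal{D}}=\mathcal{D}(1+\mathcal{D}^2)^{-1/2}$, a bounded operator on $H$, and let $A\subseteq N$ be the norm closure of (the image of) $\mathcal{A}$. Then for every $a\in A$ $$[F_{\mathcal{D}},a]\in J,\qquad a(1-F_{\mathcal{D}}^2)\in J,\qquad a(F_{\mathcal{D}}-F_{\mathcal{D}}^*)\in J.$$ Moreover $F_{\mathcal{D}}\in N$. Suppose in addition that $J$ is $\sigma$-unital, i.e. that it has a sequential approximate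 unit, and regard $J$ as a right Hilbert $J$-module with $\langle x,y\rangle=x^*y$. Let $\mathcal{M}_A:A\to\mathcal{L}(J)$ be left multiplication, and let $F_{\mathcal{D}}\in\mathcal{L}(J)$ act by left multiplication. Then $(\mathcal{M}_A,F_{\mathcal{D}})$ is an (ungraded, i.e. odd) Kasparov $A$-$J$-module: $J$ is a countably generated Hilbert $J$-module, $\mathcal{M}_A$ is a $*$-homomorphism, and $\mathcal{M}_A(a)(F_{\mathcal{D}}^2-1)$, $\mathcal{M}_A(a)(F_{\mathcal{D}}-F_{\mathcal{D}}^*)$ and $[F_{\mathcal{D}},\mathcal{M}_A(a)]$ are compact operators on this Hilbert module for all $a\in A$. Equivalently, let $\mathbb{C}_1=\mathbb{C}\oplus\mathbb{C}$ carry the grading that exchanges the two summands, and put $\varepsilon=(1,-1)$. Then $(\mathcal{M}_A\hat\otimes 1,\,F_{\mathcal{D}}\hat\otimes\varepsilon)$ is a $\mathbb{Z}_2$-graded Kasparov $A$-$(J\hat\otimes\mathbb{C}_1)$-module, with $A$ trivially graded. -/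

import Mathlib

/-! ### Unbounded self-adjoint operators -/

namespace UnboundedOp

open scoped ComplexConjugate

variable {H : Type*} [NormedAddCommGroup H] [InnerProductSpace ℂ H] [CompleteSpace H]

theorem symm_apply {D : H →ₗ.[ℂ] H} (hD : IsSelfAdjoint D) (x y : D.domain) :
    inner ℂ (D x) (y : H) = inner ℂ (x : H) (D y) := by
  have h := LinearPMap.adjoint_isFormalAdjoint (T := D) hD.dense_domain
  rw [LinearPMap.isSelfAdjoint_def.mp hD] at h
  exact h x y

theorem mem_domain_of_inner {D : H →ₗ.[ℂ] H} (hD : IsSelfAdjoint D) {y w : H}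
    (h : ∀ x : D.domain, inner ℂ w (x : H) = inner ℂ y (D x)) :
    ∃ hy : y ∈ D.domain, D ⟨y, hy⟩ = w := by
  have h1 := LinearPMap.mem_adjoint_domain_of_exists (T := D) y ⟨w, h⟩
  have h2 := LinearPMap.adjoint_apply_eq (T := D) hD.dense_domain ⟨y, h1⟩ h
  revert h1
  rw [LinearPMap.isSelfAdjoint_def.mp hD]
  exact fun h1 h2 => ⟨h1, h2⟩

theorem norm_lower_bound {D : H →ₗ.[ℂ] H} (hD : IsSelfAdjoint D) (z : ℂ) (x : D.domain) :
    |z.im| * ‖(x : H)‖ ≤ ‖z • (x : H) - D x‖ := by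
  have hreal : (inner ℂ (x : H) (D x)).im = 0 := by
    have h1 := symm_apply hD x x
    rw [← inner_conj_symm] at h1
    exact Complex.conj_eq_iff_im.mp h1
  have h2 : (inner ℂ (x : H) (z • (x : H) - D x)).im = z.im * ‖(x : H)‖ ^ 2 := by
    rw [inner_sub_right, inner_smul_right, inner_self_eq_norm_sq_to_K, Complex.sub_im, hreal]
    simp [← Complex.ofReal_pow]
  have h3 : |z.im| * ‖(x : H)‖ ^ 2 ≤ ‖(x : H)‖ * ‖z • (x : H) - D x‖ := by
    calc |z.im| * ‖(x : H)‖ ^ 2 = |(inner ℂ (x : H) (z • (x : H) - D x)).im| := by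
          rw [h2, abs_mul, abs_of_nonneg (sq_nonneg ‖(x : H)‖)]
      _ ≤ ‖inner ℂ (x : H) (z • (x : H) - D x)‖ := Complex.abs_im_le_norm _
      _ ≤ _ := norm_inner_le_norm _ _
  rcases (norm_nonneg (x : H)).eq_or_lt with h0 | h0
  · rw [← h0]; simp
  · nlinarith

/-- `R` is the (everywhere defined, bounded) inverse of `z - D`. -/
def IsResolvent (D : H →ₗ.[ℂ] H) (z : ℂ) (R : H →L[ℂ] H) : Prop :=
  (∀ x : H, ∃ h : R x ∈ D.domain, z • R x - D ⟨R x, h⟩ = x) ∧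
    ∀ x : D.domain, R (z • (x : H) - D x) = x

theorem exists_isResolvent {D : H →ₗ.[ℂ] H} (hD : IsSelfAdjoint D) {z : ℂ} (hz : z.im ≠ 0) :
    ∃ R : H →L[ℂ] H, IsResolvent D z R := by
  have hz' : 0 < |z.im| := abs_pos.mpr hz
  have hcl : IsClosed (D.graph : Set (H × H)) := hD.isClosed
  have : CompleteSpace D.graph := hcl.completeSpace_coe
  let φ : D.graph →L[ℂ] H :=
    (z • ContinuousLinearMap.fst ℂ H H - ContinuousLinearMap.snd ℂ H H).comp D.graph.subtypeL
  have hφ : ∀ p : D.graph, φ p = z • (p : H × H).1 - (p : H × H).2 := fun p => rfl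
  have hb : ∀ p : D.graph, ‖(p : H × H).1‖ ≤ |z.im|⁻¹ * ‖φ p‖ := by
    rintro ⟨⟨a, b⟩, hp⟩
    obtain ⟨x, hx1, hx2⟩ := (LinearPMap.mem_graph_iff _).mp hp
    simp only at hx1 hx2
    have := norm_lower_bound hD z x
    rw [hφ]
    simp only [← hx1, ← hx2]
    rw [inv_mul_eq_div, le_div_iff₀ hz']
    linarith
  have hanti : ∃ K, AntilipschitzWith K φ := by
    refine ⟨Real.toNNReal (|z.im|⁻¹ + (‖z‖ * |z.im|⁻¹ + 1)), ?_⟩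
    refine ContinuousLinearMap.antilipschitz_of_bound φ fun p => ?_
    rw [Real.coe_toNNReal _ (by positivity)]
    have h1 := hb p
    have h2 : ‖(p : H × H).2‖ ≤ ‖z‖ * ‖(p : H × H).1‖ + ‖φ p‖ := by
      have : (p : H × H).2 = z • (p : H × H).1 - φ p := by rw [hφ]; abel
      rw [this, ← norm_smul]
      exact norm_sub_le _ _
    have h3 : ‖p‖ = max ‖(p : H × H).1‖ ‖(p : H × H).2‖ := rfl
    have h4 : ‖z‖ * ‖(p : H × H).1‖ ≤ ‖z‖ * (|z.im|⁻¹ * ‖φ p‖) := by gcongr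
    have h5 : 0 ≤ |z.im|⁻¹ * ‖φ p‖ := by positivity
    have h6 : 0 ≤ ‖z‖ * (|z.im|⁻¹ * ‖φ p‖) := by positivity
    rw [h3]
    refine max_le ?_ ?_ <;> nlinarith [norm_nonneg (φ p)]
  obtain ⟨K, hK⟩ := hanti
  have hker : φ.ker = ⊥ := LinearMap.ker_eq_bot.mpr hK.injective
  have hrcl : IsClosed (φ.range : Set H) := by
    have h1 := hK.isClosed_range φ.uniformContinuous
    have h2 : (φ.range : Set H) = Set.range φ := LinearMap.coe_range _
    rw [h2]
    exact h1
  have hrange : φ.range = ⊤ := by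
    have : CompleteSpace φ.range := hrcl.completeSpace_coe
    rw [← Submodule.orthogonal_eq_bot_iff, Submodule.eq_bot_iff]
    intro y hy
    have h1 : ∀ x : D.domain, inner ℂ (conj z • y) (x : H) = inner ℂ y (D x) := by
      intro x
      have hx : φ ⟨((x : H), D x), LinearPMap.mem_graph D x⟩ ∈ φ.range := ⟨_, rfl⟩
      have h2 := (Submodule.mem_orthogonal' _ _).mp hy _ hx
      rw [hφ, inner_sub_right, inner_smul_right, sub_eq_zero] at h2
      rw [inner_smul_left, Complex.conj_conj]
      exact h2
    obtain ⟨hy1, hy2⟩ := mem_domain_of_inner hD h1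
    have h3 := norm_lower_bound hD (conj z) ⟨y, hy1⟩
    rw [hy2] at h3
    simp only [sub_self, norm_zero, Complex.conj_im, abs_neg] at h3
    have : ‖y‖ ≤ 0 := by nlinarith [norm_nonneg y]
    exact norm_le_zero_iff.mp this
  let e := ContinuousLinearEquiv.ofBijective φ hker hrange
  refine ⟨(ContinuousLinearMap.fst ℂ H H).comp
    (D.graph.subtypeL.comp (e.symm : H →L[ℂ] D.graph)), ?_, ?_⟩
  · intro x
    obtain ⟨w, hw1, hw2⟩ := (LinearPMap.mem_graph_iff _).mp (e.symm x).2
    have hx : φ (e.symm x) = x := ContinuousLinearEquiv.ofBijective_apply_symm_apply φ hker hrange x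
    have hR : ((ContinuousLinearMap.fst ℂ H H).comp (D.graph.subtypeL.comp
        (e.symm : H →L[ℂ] D.graph))) x = (w : H) := hw1.symm
    refine ⟨by rw [hR]; exact w.2, ?_⟩
    simp only [hR]
    refine Eq.trans ?_ hx
    rw [hφ, ← hw1, ← hw2]
  · intro x
    have : e ⟨((x : H), D x), LinearPMap.mem_graph D x⟩ = z • (x : H) - D x := rfl
    rw [← this]
    simp

/-- The resolvent `(z - D)⁻¹` of a self-adjoint operator at a non-real `z`. -/
noncomputable def resolvent (D : H →ₗ.[ℂ] H) (hD : IsSelfAdjoint D) (z : ℂ) (hz : z.im ≠ 0) :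
    H →L[ℂ] H :=
  (exists_isResolvent hD hz).choose

theorem resolvent_spec (D : H →ₗ.[ℂ] H) (hD : IsSelfAdjoint D) (z : ℂ) (hz : z.im ≠ 0) :
    IsResolvent D z (resolvent D hD z hz) :=
  (exists_isResolvent hD hz).choose_spec

/-- `R` is the (everywhere defined, bounded) inverse of `1 + D ^ 2`, where `D ^ 2` has the
domain of all `x` in the domain of `D` such that `D x` is in the domain of `D`. -/
def IsInvOneAddSq (D : H →ₗ.[ℂ] H) (R : H →L[ℂ] H) : Prop :=
  (∀ x : H, ∃ (h : R x ∈ D.domain) (h' : D ⟨R x, h⟩ ∈ D.domain),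
      R x + D ⟨D ⟨R x, h⟩, h'⟩ = x) ∧
    ∀ (x : D.domain) (h : D x ∈ D.domain), R ((x : H) + D ⟨D x, h⟩) = x

theorem exists_isInvOneAddSq {D : H →ₗ.[ℂ] H} (hD : IsSelfAdjoint D) :
    ∃ R : H →L[ℂ] H, IsInvOneAddSq D R := by
  obtain ⟨P, hP1, hP2⟩ := exists_isResolvent hD (z := Complex.I) (by simp)
  obtain ⟨Q, hQ1, hQ2⟩ := exists_isResolvent hD (z := -Complex.I) (by simp)
  refine ⟨Q.comp P, fun x => ?_, fun x h => ?_⟩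
  · obtain ⟨hu, hu'⟩ := hP1 x
    obtain ⟨hw, hw'⟩ := hQ1 (P x)
    have hDw : D ⟨Q (P x), hw⟩ = -Complex.I • Q (P x) - P x :=
      (sub_eq_iff_eq_add.mp hw' |>.trans (add_comm _ _) |> sub_eq_iff_eq_add.mpr).symm
    have hmem : D ⟨Q (P x), hw⟩ ∈ D.domain := by
      rw [hDw]; exact D.domain.sub_mem (D.domain.smul_mem _ hw) hu
    refine ⟨hw, hmem, ?_⟩
    have hsub : (⟨D ⟨Q (P x), hw⟩, hmem⟩ : D.domain) =
        -Complex.I • (⟨Q (P x), hw⟩ : D.domain) - ⟨P x, hu⟩ := Subtype.ext hDw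
    have : D ⟨D ⟨Q (P x), hw⟩, hmem⟩ =
        -Complex.I • D ⟨Q (P x), hw⟩ - D ⟨P x, hu⟩ := by
      rw [hsub, LinearPMap.map_sub, LinearPMap.map_smul]
    change Q (P x) + D ⟨D ⟨Q (P x), hw⟩, hmem⟩ = x
    rw [this, hDw, smul_sub, smul_smul]
    have hI : -Complex.I * -Complex.I = -1 := by simp
    rw [hI]
    refine Eq.trans ?_ hu'
    module
  · have hv : -Complex.I • (x : H) - D x ∈ D.domain :=
      D.domain.sub_mem (D.domain.smul_mem _ x.2) h
    have hsub : (⟨-Complex.I • (x : H) - D x, hv⟩ : D.domain) = -Complex.I • x - ⟨D x, h⟩ := rfl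
    have h1 : Complex.I • (-Complex.I • (x : H) - D x) - D ⟨-Complex.I • (x : H) - D x, hv⟩ =
        (x : H) + D ⟨D x, h⟩ := by
      rw [hsub, LinearPMap.map_sub, LinearPMap.map_smul, smul_sub, smul_smul]
      have hI : Complex.I * -Complex.I = 1 := by simp
      rw [hI]
      module
    have h2 := hP2 ⟨_, hv⟩
    simp only [h1] at h2
    rw [ContinuousLinearMap.comp_apply, h2, hQ2 x]

/-- The bounded operator `(1 + D ^ 2)⁻¹` of a self-adjoint operator `D`. -/
noncomputable def invOneAddSq (D : H →ₗ.[ℂ] H) (hD : IsSelfAdjoint D) : H →L[ℂ] H :=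
  (exists_isInvOneAddSq hD).choose

theorem invOneAddSq_spec (D : H →ₗ.[ℂ] H) (hD : IsSelfAdjoint D) :
    IsInvOneAddSq D (invOneAddSq D hD) :=
  (exists_isInvOneAddSq hD).choose_spec

theorem inner_invOneAddSq {D : H →ₗ.[ℂ] H} (hD : IsSelfAdjoint D) {R : H →L[ℂ] H}
    (hR : IsInvOneAddSq D R) (x : H) (h : R x ∈ D.domain) :
    inner ℂ (R x) x = ((‖R x‖ ^ 2 + ‖D ⟨R x, h⟩‖ ^ 2 : ℝ) : ℂ) := by
  obtain ⟨h1, h2, h3⟩ := hR.1 x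
  nth_rewrite 2 [← h3]
  have := symm_apply hD ⟨R x, h⟩ ⟨D ⟨R x, h⟩, h2⟩
  simp only at this
  rw [inner_add_right, ← this, inner_self_eq_norm_sq_to_K, inner_self_eq_norm_sq_to_K]
  push_cast
  rfl

theorem invOneAddSq_nonneg (D : H →ₗ.[ℂ] H) (hD : IsSelfAdjoint D) :
    0 ≤ invOneAddSq D hD := by
  rw [ContinuousLinearMap.nonneg_iff_isPositive, ContinuousLinearMap.isPositive_iff_complex]
  intro x
  obtain ⟨h1, -⟩ := (invOneAddSq_spec D hD).1 x
  rw [inner_invOneAddSq hD (invOneAddSq_spec D hD) x h1]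
  rw [RCLike.re_to_complex, Complex.ofReal_re]
  exact ⟨rfl, by positivity⟩

/-- `F = D (1 + D ^ 2) ^ (-1/2)`: the operator `(1 + D ^ 2) ^ (-1/2)`, the positive square root
of `(1 + D ^ 2)⁻¹`, maps `H` into the domain of `D`, and `F` is its composition with `D`. -/
def IsBoundedTransform (D : H →ₗ.[ℂ] H) (hD : IsSelfAdjoint D) (F : H →L[ℂ] H) : Prop :=
  ∀ x : H, ∃ h : CFC.sqrt (invOneAddSq D hD) x ∈ D.domain,
    F x = D ⟨CFC.sqrt (invOneAddSq D hD) x, h⟩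

theorem exists_isBoundedTransform {D : H →ₗ.[ℂ] H} (hD : IsSelfAdjoint D) :
    ∃ F : H →L[ℂ] H, IsBoundedTransform D hD F := by
  set R := invOneAddSq D hD with hRdef
  have hR : IsInvOneAddSq D R := invOneAddSq_spec D hD
  have hR0 : 0 ≤ R := invOneAddSq_nonneg D hD
  set S := CFC.sqrt R with hSdef
  have hSS : ∀ x, S (S x) = R x := fun x =>
    congrArg (fun T : H →L[ℂ] H => T x) (CFC.sqrt_mul_sqrt_self R hR0)
  have hS0 : 0 ≤ S := CFC.sqrt_nonneg R
  have hSsa : ∀ x y, inner ℂ (S x) y = inner ℂ x (S y) :=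
    ((ContinuousLinearMap.nonneg_iff_isPositive S).mp hS0).isSymmetric
  have hinj : ∀ x, S x = 0 → x = 0 := by
    intro x hx
    have hRx : R x = 0 := by rw [← hSS, hx, map_zero]
    obtain ⟨h1, h2, h3⟩ := hR.1 x
    have e1 : (⟨R x, h1⟩ : D.domain) = 0 := Subtype.ext hRx
    have e2 : (⟨D ⟨R x, h1⟩, h2⟩ : D.domain) = 0 := by
      apply Subtype.ext
      change D ⟨R x, h1⟩ = 0
      rw [e1, LinearPMap.map_zero]
    rw [e2, LinearPMap.map_zero, hRx, add_zero] at h3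
    exact h3.symm
  have hdense : Dense (Set.range S) := by
    have : Dense (S.range : Set H) := by
      rw [Submodule.dense_iff_topologicalClosure_eq_top,
        Submodule.topologicalClosure_eq_top_iff, Submodule.eq_bot_iff]
      intro y hy
      apply hinj
      have := (Submodule.mem_orthogonal _ _).mp hy (S (S y)) ⟨_, rfl⟩
      rw [hSsa] at this
      exact inner_self_eq_zero.mp this
    have h2 : (S.range : Set H) = Set.range S := LinearMap.coe_range _
    rw [← h2]
    exact this
  have hiso : ∀ x, ∃ h : S (S x) ∈ D.domain, ‖D ⟨S (S x), h⟩‖ ≤ ‖S x‖ := by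
    intro x
    obtain ⟨h1, -⟩ := hR.1 x
    have h2 := inner_invOneAddSq hD hR x h1
    rw [← hSS x] at h1
    refine ⟨h1, ?_⟩
    have h3 : inner ℂ (R x) x = ((‖S x‖ ^ 2 : ℝ) : ℂ) := by
      rw [← hSS, hSsa, inner_self_eq_norm_sq_to_K]
      push_cast
      rfl
    rw [h3] at h2
    have h4 := Complex.ofReal_injective h2
    simp only [← hSS x] at h4
    have : ‖D ⟨S (S x), h1⟩‖ ^ 2 ≤ ‖S x‖ ^ 2 := by
      rw [h4]
      nlinarith [sq_nonneg ‖S (S x)‖]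
    exact le_of_sq_le_sq this (norm_nonneg _)
  have hgr : ∀ y, ∃ h : S y ∈ D.domain, ‖D ⟨S y, h⟩‖ ≤ ‖y‖ := by
    intro y
    obtain ⟨u, hu, hlim⟩ := mem_closure_iff_seq_limit.mp (hdense y)
    choose x hx using hu
    choose hd hle using hiso
    have hlin : ∀ m n, D ⟨S (S (x m)), hd _⟩ - D ⟨S (S (x n)), hd _⟩ =
        D ⟨S (S (x m - x n)), hd _⟩ := by
      intro m n
      rw [← LinearPMap.map_sub]
      congr 1
      apply Subtype.ext
      simp
    have hcau : CauchySeq fun n => D ⟨S (S (x n)), hd _⟩ := by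
      have hu' : CauchySeq u := hlim.cauchySeq
      rw [Metric.cauchySeq_iff] at hu' ⊢
      intro ε hε
      obtain ⟨N, hN⟩ := hu' ε hε
      refine ⟨N, fun m hm n hn => ?_⟩
      rw [dist_eq_norm, hlin]
      refine (hle _).trans_lt ?_
      rw [map_sub, hx, hx, ← dist_eq_norm]
      exact hN m hm n hn
    obtain ⟨v, hv⟩ := cauchySeq_tendsto_of_complete hcau
    have hcl : IsClosed (D.graph : Set (H × H)) := hD.isClosed
    have hSu : Filter.Tendsto (fun n => S (S (x n))) Filter.atTop (nhds (S y)) := by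
      have := (S.continuous.tendsto y).comp hlim
      refine this.congr fun n => ?_
      simp [hx]
    have hmem : (S y, v) ∈ D.graph := by
      refine hcl.mem_of_tendsto (hSu.prodMk_nhds hv) (Filter.Eventually.of_forall fun n => ?_)
      exact LinearPMap.mem_graph D ⟨S (S (x n)), hd _⟩
    obtain ⟨w, hw1, hw2⟩ := (LinearPMap.mem_graph_iff _).mp hmem
    simp only at hw1 hw2
    have hSy : S y ∈ D.domain := hw1 ▸ w.2
    refine ⟨hSy, ?_⟩
    have : (⟨S y, hSy⟩ : D.domain) = w := Subtype.ext hw1.symm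
    rw [this, hw2]
    refine le_of_tendsto_of_tendsto hv.norm hlim.norm (Filter.Eventually.of_forall fun n => ?_)
    simpa [hx] using hle (x n)
  choose hd hle using hgr
  let F : H →ₗ[ℂ] H :=
    { toFun := fun y => D ⟨S y, hd y⟩
      map_add' := fun a b => by
        rw [← LinearPMap.map_add]; congr 1; apply Subtype.ext; simp
      map_smul' := fun c a => by
        rw [RingHom.id_apply, ← LinearPMap.map_smul]; congr 1; apply Subtype.ext; simp }
  exact ⟨F.mkContinuous 1 fun y => by
    rw [one_mul]
    exact hle y, fun x => ⟨hd x, rfl⟩⟩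

/-- The bounded operator `D (1 + D ^ 2) ^ (-1/2)` of a self-adjoint operator `D`. -/
noncomputable def boundedTransform (D : H →ₗ.[ℂ] H) (hD : IsSelfAdjoint D) : H →L[ℂ] H :=
  (exists_isBoundedTransform hD).choose

theorem boundedTransform_spec (D : H →ₗ.[ℂ] H) (hD : IsSelfAdjoint D) :
    IsBoundedTransform D hD (boundedTransform D hD) :=
  (exists_isBoundedTransform hD).choose_spec

end UnboundedOp

/-! ### Closed ideals are self-adjoint -/

theorem norm_star_mul_pow_le {A : Type*} [CStarAlgebra A] [PartialOrder A] [StarOrderedRing A]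
    (x : A) (hx : ‖x‖ ≤ 1) (n : ℕ) :
    ‖star x * (1 - x * star x) ^ n‖ ^ 2 * (1 + 2 * n) ≤ 2 * 1 := by
  nontriviality A
  set b := x * star x with hb
  have hb0 : 0 ≤ b := mul_star_self_nonneg x
  have hsa : IsSelfAdjoint b := .of_nonneg hb0
  have hb1 : ‖b‖ ≤ 1 := by
    rw [hb, CStarRing.norm_self_mul_star]
    nlinarith [norm_nonneg x]
  have hsp : ∀ t ∈ spectrum ℝ b, 0 ≤ t ∧ t ≤ 1 := fun t ht =>
    ⟨spectrum_nonneg_of_nonneg hb0 ht,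
      (le_abs_self t).trans ((spectrum.norm_le_norm_of_mem ht).trans hb1)⟩
  have h1 : ‖star x * (1 - b) ^ n‖ ^ 2 = ‖b * (1 - b) ^ (2 * n)‖ := by
    rw [sq, ← CStarRing.norm_star_mul_self, star_mul, star_star, star_pow, star_sub, star_one,
      hsa.star_eq, mul_assoc, ← mul_assoc x, ← hb, ← mul_assoc]
    have : Commute ((1 - b) ^ n) b := ((Commute.one_left b).sub_left (Commute.refl b)).pow_left n
    rw [this.eq, mul_assoc, ← pow_add, two_mul]
  have h2 : b * (1 - b) ^ (2 * n) = cfc (fun t : ℝ => t * (1 - t) ^ (2 * n)) b := by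
    rw [cfc_mul (fun t : ℝ => t) (fun t : ℝ => (1 - t) ^ (2 * n)) b,
      cfc_pow (fun t : ℝ => 1 - t) (2 * n) b, cfc_sub (fun _ : ℝ => 1) (fun t => t) b,
      cfc_id' ℝ b, cfc_const_one ℝ b]
  have hn : (0 : ℝ) < 1 + 2 * n := by positivity
  rw [h1, h2, ← le_div_iff₀ hn]
  refine norm_cfc_le (by positivity) fun t ht => ?_
  obtain ⟨ht0, ht1⟩ := hsp t ht
  have h3 : (1 - t) ^ (2 * n) * (1 + (2 * n : ℕ) * t) ≤ 1 := by
    calc (1 - t) ^ (2 * n) * (1 + (2 * n : ℕ) * t) ≤ (1 - t) ^ (2 * n) * (1 + t) ^ (2 * n) := by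
          gcongr
          exact one_add_mul_le_pow (by linarith) _
      _ = (1 - t ^ 2) ^ (2 * n) := by rw [← mul_pow]; ring
      _ ≤ 1 := pow_le_one₀ (by nlinarith) (by nlinarith)
  have h4 : (1 - t) ^ (2 * n) ≤ 1 := pow_le_one₀ (by linarith) (by linarith)
  have h5 : 0 ≤ (1 - t) ^ (2 * n) := by positivity
  rw [Real.norm_of_nonneg (by positivity), le_div_iff₀ hn]
  push_cast at h3
  nlinarith

theorem star_mem_of_closed {A : Type*} [CStarAlgebra A] [PartialOrder A] [StarOrderedRing A]
    {N : Type*} [SetLike N A] [SubringClass N A] [StarMemClass N A] [SMulMemClass N ℂ A]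
    (M : N) (J : TwoSidedIdeal M)
    (hJ : IsClosed (J : Set M)) {x : M} (hx : x ∈ J) : star x ∈ J := by
  -- it suffices to treat contractions
  have key : ∀ y : M, ‖y‖ ≤ 1 → y ∈ J → star y ∈ J := by
    intro y hy hyJ
    let u : ℕ → M := fun n => star y * (1 - (1 - y * star y) ^ n)
    have hu : ∀ n, u n ∈ J := by
      intro n
      refine J.mul_mem_left _ _ ?_
      have h := mul_neg_geom_sum (1 - y * star y) n
      rw [sub_sub_cancel] at h
      rw [← h, mul_assoc]
      exact J.mul_mem_right _ _ hyJ
    refine hJ.mem_of_tendsto (f := u) (b := Filter.atTop) ?_ (Filter.Eventually.of_forall hu)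
    rw [tendsto_iff_norm_sub_tendsto_zero]
    have hle : ∀ n : ℕ, ‖u n - star y‖ ≤ Real.sqrt (2 / (1 + 2 * n)) := by
      intro n
      have h1 : u n - star y = -(star y * (1 - y * star y) ^ n) := by
        simp only [u, mul_sub, mul_one]; abel
      have hn : (0 : ℝ) < 1 + 2 * n := by positivity
      refine Real.le_sqrt_of_sq_le ?_
      rw [h1, norm_neg, le_div_iff₀ hn]
      simpa using norm_star_mul_pow_le (y : A) hy n
    refine squeeze_zero (fun n => norm_nonneg _) hle ?_
    have h2 : Filter.Tendsto (fun n : ℕ => (2 : ℝ) / (1 + 2 * n)) Filter.atTop (nhds 0) := by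
      refine Filter.Tendsto.div_atTop tendsto_const_nhds ?_
      refine Filter.tendsto_atTop_add_const_left _ _ ?_
      exact tendsto_natCast_atTop_atTop.const_mul_atTop (by norm_num)
    have h3 := (Real.continuous_sqrt.tendsto 0).comp h2
    rw [Real.sqrt_zero] at h3
    exact h3
  let c : M := (((‖x‖ + 1 : ℝ) : ℂ)) • 1
  let d : M := ((((‖x‖ + 1)⁻¹ : ℝ) : ℂ)) • 1
  have hpos : 0 < ‖x‖ + 1 := by positivity
  have h1 : star (d * x) ∈ J := by
    refine key _ ?_ (J.mul_mem_left _ _ hx)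
    have : d * x = ((((‖x‖ + 1)⁻¹ : ℝ) : ℂ)) • x := by
      simp only [d, smul_mul_assoc, one_mul]
    rw [this, norm_smul, Complex.norm_real, Real.norm_of_nonneg (by positivity),
      inv_mul_le_one₀ hpos]
    linarith
  have h2 : star x = c * star (d * x) := by
    have : d * x = ((((‖x‖ + 1)⁻¹ : ℝ) : ℂ)) • x := by
      simp only [d, smul_mul_assoc, one_mul]
    rw [this, star_smul]
    simp only [c, smul_mul_assoc, one_mul, smul_smul]
    rw [RCLike.star_def, Complex.conj_ofReal, ← Complex.ofReal_mul, mul_inv_cancel₀ hpos.ne']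
    simp
  rw [h2]
  exact J.mul_mem_left _ _ h1

/-! ### Hilbert modules and Kasparov modules -/

/-- A (right) Hilbert `B`-module structure on a Banach space `E`. (The axioms of Mathlib's
`CStarModule` have the scalars on the left, `⟪x, b • y⟫ = b * ⟪x, y⟫`.) -/
class HilbertModule (B E : Type*) [NonUnitalCStarAlgebra B] [NormedAddCommGroup E]
    [NormedSpace ℂ E] [CompleteSpace E] where
  /-- the right action `x · b` -/
  act : E → B → E
  /-- the `B`-valued inner product, conjugate linear in the first variable -/
  ip : E → E → B
  add_act : ∀ x y b, act (x + y) b = act x b + act y b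
  act_add : ∀ x b c, act x (b + c) = act x b + act x c
  act_mul : ∀ x b c, act x (b * c) = act (act x b) c
  smul_act : ∀ (z : ℂ) x b, act (z • x) b = z • act x b
  act_smul : ∀ (z : ℂ) x b, act x (z • b) = z • act x b
  ip_add_right : ∀ x y y', ip x (y + y') = ip x y + ip x y'
  ip_smul_right : ∀ (z : ℂ) x y, ip x (z • y) = z • ip x y
  ip_act_right : ∀ x y b, ip x (act y b) = ip x y * b
  star_ip : ∀ x y, star (ip x y) = ip y x
  ip_self_nonneg : ∀ x, ∃ b, ip x x = star b * b
  norm_sq : ∀ x, ‖x‖ ^ 2 = ‖ip x x‖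

/-- A C*-algebra as a right Hilbert module over itself: `x · b = x * b`, `⟪x, y⟫ = x⋆ * y`. -/
instance HilbertModule.self (B : Type*) [NonUnitalCStarAlgebra B] : HilbertModule B B where
  act x b := x * b
  ip x y := star x * y
  add_act := add_mul
  act_add := mul_add
  act_mul x b c := (mul_assoc x b c).symm
  smul_act := smul_mul_assoc
  act_smul z x b := mul_smul_comm z x b
  ip_add_right x := mul_add (star x)
  ip_smul_right z x y := mul_smul_comm z (star x) y
  ip_act_right x y b := (mul_assoc (star x) y b).symm
  star_ip x y := by rw [star_mul, star_star]
  ip_self_nonneg x := ⟨x, rfl⟩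
  norm_sq x := by rw [CStarRing.norm_star_mul_self, sq]

/-- `B` is σ-unital: it has a sequential approximate unit. -/
def IsSigmaUnital (B : Type*) [NonUnitalCStarAlgebra B] : Prop :=
  ∃ e : ℕ → B, (Filter.map e Filter.atTop).IsApproximateUnit

namespace HilbertModule

section
variable (B : Type*) {E : Type*} [NonUnitalCStarAlgebra B] [NormedAddCommGroup E]
  [NormedSpace ℂ E] [CompleteSpace E] [HilbertModule B E]

/-- `S` is an adjoint of `T`. -/
def IsAdjointPair (T S : E →L[ℂ] E) : Prop :=
  ∀ x y : E, ip (B := B) (T x) y = ip x (S y)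

variable (E) in
/-- `E` is countably generated: for some countable `s`, the finite sums `∑ xᵢ · bᵢ` with
`xᵢ ∈ s` and `bᵢ ∈ B` are dense in `E`. -/
def IsCountablyGenerated : Prop :=
  ∃ s : Set E, s.Countable ∧
    Dense (Submodule.span ℂ {y : E | ∃ x ∈ s, ∃ b : B, y = act x b} : Set E)

variable (E) in
/-- The compact operators `𝒦(E)`: the closed linear span of the (automatically bounded)
operators `z ↦ x · ⟪y, z⟫`. -/
noncomputable def compacts : Submodule ℂ (E →L[ℂ] E) :=
  (Submodule.span ℂ {T : E →L[ℂ] E | ∃ x y : E, ∀ z, T z = act x (ip (B := B) y z)}).topologicalClosure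

/-- The conditions on a pair `(ψ, V)` to be a Kasparov `A`-`B`-module for C*-algebras `A` and `B`
without grading (an odd, or ungraded, Kasparov module): `E` is a countably generated Hilbert
`B`-module, `ψ : A → ℒ(E)` is a *-homomorphism, `V ∈ ℒ(E)`, and `ψ(a) (V² - 1)`,
`ψ(a) (V - V*)`, `[V, ψ(a)]` are in `𝒦(E)`. -/
structure IsKasparovModule {A : Type*} [NonUnitalCStarAlgebra A]
    (ψ : A →ₙₐ[ℂ] (E →L[ℂ] E)) (V : E →L[ℂ] E) : Prop where
  countablyGenerated : IsCountablyGenerated B E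
  star_hom : ∀ a, IsAdjointPair B (ψ a) (ψ (star a))
  sq_sub_one : ∀ a, ψ a * (V * V - 1) ∈ compacts B E
  sub_adjoint : ∃ W, IsAdjointPair B V W ∧ ∀ a, ψ a * (V - W) ∈ compacts B E
  commutator : ∀ a, V * ψ a - ψ a * V ∈ compacts B E

/-- The conditions on a pair `(ψ, V)` to be a Kasparov `A`-`B`-module for `ℤ₂`-graded C*-algebras
`A` and `B`. The gradings of `A`, `B` and `E` are given by the involutions `α`, `β` and `γ`
whose `±1`-eigenspaces are the even and the odd part; the commutator is the graded one, which is
`V ψ(a) - ψ(α(a)) V` as `V` is odd. -/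
structure IsGradedKasparovModule {A : Type*} [NonUnitalCStarAlgebra A]
    (α : A →⋆ₙₐ[ℂ] A) (β : B →⋆ₙₐ[ℂ] B) (γ : E →L[ℂ] E)
    (ψ : A →ₙₐ[ℂ] (E →L[ℂ] E)) (V : E →L[ℂ] E) : Prop where
  grading_left : ∀ a, α (α a) = a
  grading_right : ∀ b, β (β b) = b
  grading_module : ∀ x, γ (γ x) = x
  grading_act : ∀ x (b : B), γ (act x b) = act (γ x) (β b)
  grading_ip : ∀ x y, ip (γ x) (γ y) = β (ip (B := B) x y)
  countablyGenerated : IsCountablyGenerated B E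
  star_hom : ∀ a, IsAdjointPair B (ψ a) (ψ (star a))
  graded_hom : ∀ a x, γ (ψ a x) = ψ (α a) (γ x)
  odd : ∀ x, γ (V x) = -V (γ x)
  sq_sub_one : ∀ a, ψ a * (V * V - 1) ∈ compacts B E
  sub_adjoint : ∃ W, IsAdjointPair B V W ∧ ∀ a, ψ a * (V - W) ∈ compacts B E
  commutator : ∀ a, V * ψ a - ψ (α a) * V ∈ compacts B E

end

section
variable {A B : Type*} [NonUnitalCStarAlgebra A] [NonUnitalCStarAlgebra B]

/-- `ψ ⊗ 1` on `B ⊗ ℂ₁ = B × B`, where `ℂ₁ = ℂ ⊕ ℂ`. -/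
noncomputable def tensorOne (ψ : A →ₙₐ[ℂ] (B →L[ℂ] B)) : A →ₙₐ[ℂ] (B × B →L[ℂ] B × B) where
  toFun a := (ψ a).prodMap (ψ a)
  map_smul' z a := by ext x <;> simp
  map_zero' := by ext x <;> simp
  map_add' a b := by ext x <;> simp
  map_mul' a b := by ext x <;> simp

/-- `V ⊗ ε` on `B ⊗ ℂ₁ = B × B`, where `ε = (1, -1)` in `ℂ₁ = ℂ ⊕ ℂ`. -/
noncomputable def tensorEps (V : B →L[ℂ] B) : B × B →L[ℂ] B × B := V.prodMap (-V)

variable (B) in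
/-- The standard odd grading of `B ⊗ ℂ₁ = B × B`: the flip. -/
noncomputable def flip : B × B →⋆ₙₐ[ℂ] B × B where
  toFun p := (p.2, p.1)
  map_smul' _ _ := rfl
  map_zero' := rfl
  map_add' _ _ := rfl
  map_mul' _ _ := rfl
  map_star' _ := rfl

variable (B) in
/-- The flip, as a bounded operator. -/
noncomputable def flipL : B × B →L[ℂ] B × B :=
  (ContinuousLinearMap.snd ℂ B B).prod (ContinuousLinearMap.fst ℂ B B)

end

end HilbertModule

/-! ### Norm closed ideals of von Neumann algebras -/

/-- A norm closed two-sided ideal of a von Neumann algebra. -/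
structure ClosedIdeal {H : Type*} [NormedAddCommGroup H] [InnerProductSpace ℂ H] [CompleteSpace H]
    (N : VonNeumannAlgebra H) where
  /-- the ideal -/
  ideal : TwoSidedIdeal N
  isClosed : IsClosed (ideal : Set N)

namespace ClosedIdeal

variable {H : Type*} [NormedAddCommGroup H] [InnerProductSpace ℂ H] [CompleteSpace H]
  {N : VonNeumannAlgebra H}

instance instSMulMemClass : SMulMemClass (VonNeumannAlgebra H) ℂ (H →L[ℂ] H) where
  smul_mem {N} c _ hx := N.toStarSubalgebra.smul_mem hx c

theorem star_mem_vN {x : H →L[ℂ] H} (hx : x ∈ N) : star x ∈ N :=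
  N.toStarSubalgebra.star_mem' hx

theorem isClosed_vN (N : VonNeumannAlgebra H) : IsClosed (N : Set (H →L[ℂ] H)) := by
  rw [← N.centralizer_centralizer]
  exact Set.isClosed_centralizer _

/-- Closed ideals are self-adjoint. -/
theorem star_mem_ideal (J : ClosedIdeal N) {x : N} (hx : x ∈ J.ideal) : star x ∈ J.ideal :=
  star_mem_of_closed N J.ideal J.isClosed hx

/-- A closed ideal of `N`, as a C*-algebra of operators. -/
def alg (J : ClosedIdeal N) : NonUnitalStarSubalgebra ℂ (H →L[ℂ] H) where
  carrier := {x | ∃ h : x ∈ N, (⟨x, h⟩ : N) ∈ J.ideal}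
  zero_mem' := ⟨zero_mem N, J.ideal.zero_mem⟩
  add_mem' := fun ⟨h, hJ⟩ ⟨h', hJ'⟩ => ⟨add_mem h h', J.ideal.add_mem hJ hJ'⟩
  mul_mem' := fun ⟨h, _⟩ ⟨h', hJ'⟩ => ⟨mul_mem h h', J.ideal.mul_mem_left ⟨_, h⟩ _ hJ'⟩
  smul_mem' := fun c x ⟨h, hJ⟩ => by
    refine ⟨SMulMemClass.smul_mem c h, ?_⟩
    have := J.ideal.mul_mem_left ⟨c • 1, SMulMemClass.smul_mem c (one_mem N)⟩ _ hJ
    convert this using 1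
    apply Subtype.ext
    simp
  star_mem' := fun {x} hx => by
    obtain ⟨h, hJ⟩ := hx
    have h2 := J.star_mem_ideal hJ
    have h3 : star (⟨x, h⟩ : N) = ⟨star x, star_mem_vN h⟩ := rfl
    rw [h3] at h2
    exact ⟨star_mem_vN h, h2⟩

theorem mem_alg {J : ClosedIdeal N} {x : H →L[ℂ] H} :
    x ∈ J.alg ↔ ∃ h : x ∈ N, (⟨x, h⟩ : N) ∈ J.ideal := Iff.rfl

instance isClosed_alg (J : ClosedIdeal N) : IsClosed (J.alg : Set (H →L[ℂ] H)) := by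
  have h : (J.alg : Set (H →L[ℂ] H)) = Subtype.val '' (J.ideal : Set N) := by
    ext x
    constructor
    · rintro ⟨h, hJ⟩
      exact ⟨⟨x, h⟩, hJ, rfl⟩
    · rintro ⟨y, hJ, rfl⟩
      exact ⟨y.2, hJ⟩
  rw [h]
  exact (isClosed_vN N).isClosedMap_subtype_val _ J.isClosed

/-- Left multiplication by `T ∈ N` on a closed ideal of `N`. -/
noncomputable def leftMul (J : ClosedIdeal N) (T : H →L[ℂ] H) (hT : T ∈ N) : J.alg →L[ℂ] J.alg :=
  LinearMap.mkContinuous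
    { toFun := fun x => ⟨T * x, mul_mem hT x.2.1, J.ideal.mul_mem_left ⟨T, hT⟩ _ x.2.2⟩
      map_add' := fun x y => Subtype.ext (mul_add T (x : H →L[ℂ] H) y)
      map_smul' := fun c x => Subtype.ext (mul_smul_comm c T (x : H →L[ℂ] H)) }
    ‖T‖ fun x => norm_mul_le T (x : H →L[ℂ] H)

/-- For a *-subalgebra `A` of `N`, the map that sends `a ∈ A` to left multiplication by `a`
on the ideal. -/
noncomputable def leftMulHom (J : ClosedIdeal N) (A : NonUnitalStarSubalgebra ℂ (H →L[ℂ] H))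
    (hA : ∀ a ∈ A, a ∈ N) : A →ₙₐ[ℂ] (J.alg →L[ℂ] J.alg) where
  toFun a := J.leftMul a (hA a a.2)
  map_smul' c a := by
    ext1 x
    exact Subtype.ext (smul_mul_assoc c (a : H →L[ℂ] H) (x : H →L[ℂ] H))
  map_zero' := by
    ext1 x
    exact Subtype.ext (zero_mul (x : H →L[ℂ] H))
  map_add' a b := by
    ext1 x
    exact Subtype.ext (add_mul (a : H →L[ℂ] H) b (x : H →L[ℂ] H))
  map_mul' a b := by
    ext1 x
    exact Subtype.ext (mul_assoc (a : H →L[ℂ] H) b (x : H →L[ℂ] H))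

end ClosedIdeal

/-! ### Von Neumann spectral triples -/

/-- A von Neumann spectral triple `(𝒜, H, D)` relative to `(N, J)`. -/
structure VNSpectralTriple {H : Type*} [NormedAddCommGroup H] [InnerProductSpace ℂ H]
    [CompleteSpace H] (N : VonNeumannAlgebra H) (J : ClosedIdeal N) (𝒜 : Type*)
    [NonUnitalRing 𝒜] [StarRing 𝒜] [Module ℂ 𝒜] where
  /-- the representation of the *-algebra `𝒜` -/
  rep : 𝒜 →⋆ₙₐ[ℂ] (H →L[ℂ] H)
  rep_mem : ∀ a, rep a ∈ N
  /-- the self-adjoint operator -/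
  D : H →ₗ.[ℂ] H
  selfAdjoint : IsSelfAdjoint D
  /-- `D` is affiliated to `N`: it commutes with the unitaries of the commutant of `N`. -/
  affiliated : ∀ u ∈ unitary (H →L[ℂ] H), u ∈ N.commutant →
    ∀ x : D.domain, ∃ h : u x ∈ D.domain, D ⟨u x, h⟩ = u (D x)
  /-- `[D, a]` is defined on the domain of `D` and extends to a bounded operator. -/
  commutator_bounded : ∀ a, ∃ (h : ∀ x ∈ D.domain, rep a x ∈ D.domain) (T : H →L[ℂ] H),
    ∀ x : D.domain, T x = D ⟨rep a x, h x x.2⟩ - rep a (D x)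
  resolvent_mem : ∀ (z : ℂ) (hz : z.im ≠ 0) (a : 𝒜),
    rep a * UnboundedOp.resolvent D selfAdjoint z hz ∈ J.alg

namespace VNSpectralTriple

variable {H : Type*} [NormedAddCommGroup H] [InnerProductSpace ℂ H] [CompleteSpace H]
  {N : VonNeumannAlgebra H} {J : ClosedIdeal N} {𝒜 : Type*}
  [NonUnitalRing 𝒜] [StarRing 𝒜] [Module ℂ 𝒜]

/-- The operator `F = D (1 + D ^ 2) ^ (-1/2)`. -/
noncomputable def F (t : VNSpectralTriple N J 𝒜) : H →L[ℂ] H :=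
  UnboundedOp.boundedTransform t.D t.selfAdjoint

/-- The C*-algebra `A`, the norm closure of (the image of) `𝒜`. -/
noncomputable def A (t : VNSpectralTriple N J 𝒜) : NonUnitalStarSubalgebra ℂ (H →L[ℂ] H) :=
  (NonUnitalStarAlgHom.range t.rep).topologicalClosure

instance isClosed_A (t : VNSpectralTriple N J 𝒜) : IsClosed (t.A : Set (H →L[ℂ] H)) :=
  NonUnitalStarSubalgebra.isClosed_topologicalClosure _

theorem mem_of_mem_A (t : VNSpectralTriple N J 𝒜) : ∀ a ∈ t.A, a ∈ N := by
  intro a ha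
  refine closure_minimal ?_ (ClosedIdeal.isClosed_vN N) ha
  rintro _ ⟨b, rfl⟩
  exact t.rep_mem b

end VNSpectralTriple

/-! ### The bounded transform of a self-adjoint operator -/

namespace UnboundedOp

open scoped ComplexConjugate

variable {H : Type*} [NormedAddCommGroup H] [InnerProductSpace ℂ H]

/-! Everything rests on the commutator with `F`. Put `R = (1 + D²)⁻¹` and `S = √R`. Integrating `r /
(1 + t² r)` over `t` gives `π √r`, so the functional calculus of `R` yields `∫ (1 + t² + D²)⁻¹ dt =
π S` in norm (`integral_resSq`). Hence, on vectors of `Dom D`, `π F` is the integral of `D (1 + t² +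
D²)⁻¹`. By partial fractions this integrand is a combination of the resolvents at `±i√(1 + t²)`.

The bound on that integrand is only of order `1/|t|`. Its commutator with `a` is better: `[(z -
D)⁻¹, a] = (z - D)⁻¹ [D, a] (z - D)⁻¹` has norm at most `‖[D, a]‖ / (1 + t²)` at these points. So `π
[F, a]` is a norm convergent integral (`integral_resOdd_commutator`). Its values lie in the closed
ideal `J`, because both `a (z - D)⁻¹` and, taking adjoints, `(z - D)⁻¹ a` do.

The rest is algebra: `1 - F² = R` is a multiple of the difference of the resolvents at `±i`, `F` is
self-adjoint, and `F` commutes with every unitary of the commutant of `N`. Continuity extends the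
memberships to the closure `A`. For σ-unital `J`, left multiplication by an element of `J` is
compact on `J` (`mem_compacts_self`).

Unbounded operators enter through pairs in their graph, so that domain proofs need not be carried
inside terms. -/

theorem mem_graph_iff_exists {D : H →ₗ.[ℂ] H} {u v : H} :
    (u, v) ∈ D.graph ↔ ∃ h : u ∈ D.domain, D ⟨u, h⟩ = v := by
  rw [LinearPMap.mem_graph_iff]
  constructor
  · rintro ⟨w, rfl, rfl⟩
    exact ⟨w.2, rfl⟩
  · rintro ⟨h, rfl⟩
    exact ⟨⟨u, h⟩, rfl, rfl⟩

theorem eq_of_mem_graph {D : H →ₗ.[ℂ] H} {u v w : H}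
    (h : (u, v) ∈ D.graph) (h' : (u, w) ∈ D.graph) : v = w := by
  obtain ⟨_, rfl⟩ := mem_graph_iff_exists.mp h
  obtain ⟨_, rfl⟩ := mem_graph_iff_exists.mp h'
  rfl

variable [CompleteSpace H]

theorem inner_eq_of_mem_graph {D : H →ₗ.[ℂ] H} (hD : IsSelfAdjoint D) {u v u' v' : H}
    (h : (u, v) ∈ D.graph) (h' : (u', v') ∈ D.graph) : inner ℂ v u' = inner ℂ u v' := by
  obtain ⟨hu, rfl⟩ := mem_graph_iff_exists.mp h
  obtain ⟨hu', rfl⟩ := mem_graph_iff_exists.mp h'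
  exact symm_apply hD ⟨u, hu⟩ ⟨u', hu'⟩

/-! ### Resolvent calculus. -/

section Resolvent

variable {D : H →ₗ.[ℂ] H} {hD : IsSelfAdjoint D}

theorem resolvent_mem_graph {z : ℂ} (hz : z.im ≠ 0) (x : H) :
    (resolvent D hD z hz x, z • resolvent D hD z hz x - x) ∈ D.graph := by
  obtain ⟨h, h'⟩ := (resolvent_spec D hD z hz).1 x
  refine mem_graph_iff_exists.mpr ⟨h, ?_⟩
  have e : ∀ p q r : H, p - q = r → q = p - r := fun p q r h => by rw [← h]; abel
  exact e _ _ _ h'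

theorem resolvent_apply_of_mem_graph {z : ℂ} (hz : z.im ≠ 0) {u v : H} (h : (u, v) ∈ D.graph) :
    resolvent D hD z hz (z • u - v) = u := by
  obtain ⟨hu, rfl⟩ := mem_graph_iff_exists.mp h
  exact (resolvent_spec D hD z hz).2 ⟨u, hu⟩

theorem resolvent_apply_snd {z : ℂ} (hz : z.im ≠ 0) {u v : H} (h : (u, v) ∈ D.graph) :
    resolvent D hD z hz v = z • resolvent D hD z hz u - u := by
  have := resolvent_apply_of_mem_graph (hD := hD) hz h
  rw [map_sub, map_smul, sub_eq_iff_eq_add] at this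
  rw [this]; abel

theorem norm_resolvent_le {z : ℂ} (hz : z.im ≠ 0) : ‖resolvent D hD z hz‖ ≤ |z.im|⁻¹ := by
  refine ContinuousLinearMap.opNorm_le_bound _ (by positivity) fun x => ?_
  obtain ⟨h, h'⟩ := (resolvent_spec D hD z hz).1 x
  have := norm_lower_bound hD z ⟨_, h⟩
  rw [h'] at this
  rwa [inv_mul_eq_div, le_div_iff₀' (abs_pos.mpr hz)]

/-- First resolvent identity; it gives the norm continuity of the integrands. -/
theorem resolvent_sub_resolvent {z w : ℂ} (hz : z.im ≠ 0) (hw : w.im ≠ 0) :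
    resolvent D hD z hz - resolvent D hD w hw =
      (w - z) • (resolvent D hD z hz * resolvent D hD w hw) := by
  ext x
  have := resolvent_apply_snd (hD := hD) hz (resolvent_mem_graph (hD := hD) hw x)
  rw [map_sub, map_smul, sub_eq_iff_eq_add] at this
  simp only [sub_apply, smul_apply,
    mul_apply_eq_comp, sub_smul, this]
  abel

/-- In the symmetry of `D` on the two graph pairs of resolvent values, the terms with the factor `z`
cancel. This is what moves the resolvent to the other side of `a` in the ideal condition. -/
theorem star_resolvent {z : ℂ} (hz : z.im ≠ 0) (hz' : (conj z).im ≠ 0) :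
    star (resolvent D hD z hz) = resolvent D hD (conj z) hz' := by
  rw [ContinuousLinearMap.star_eq_adjoint]
  symm
  rw [ContinuousLinearMap.eq_adjoint_iff]
  intro x y
  have := inner_eq_of_mem_graph hD (resolvent_mem_graph (hD := hD) hz' x)
    (resolvent_mem_graph (hD := hD) hz y)
  rw [inner_sub_left, inner_sub_right, inner_smul_left, inner_smul_right, Complex.conj_conj,
    sub_right_inj] at this
  exact this.symm

/-- The commutator of a resolvent with an operator `a` such that `T` extends `[D, a]`. -/
theorem resolvent_commutator {z : ℂ} (hz : z.im ≠ 0) {a T : H →L[ℂ] H}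
    (ha : ∀ u v, (u, v) ∈ D.graph → (a u, T u + a v) ∈ D.graph) :
    resolvent D hD z hz * a - a * resolvent D hD z hz =
      resolvent D hD z hz * T * resolvent D hD z hz := by
  ext x
  -- With `R` the resolvent, `z - D` sends `a R x` to `a x - T R x`; applying `R` gives the
  -- identity.
  have := resolvent_apply_of_mem_graph (hD := hD) hz
    (ha _ _ (resolvent_mem_graph (hD := hD) hz x))
  have e : ∀ p q r : H, p - (q + (p - r)) = r - q := fun p q r => by abel
  rw [map_sub a, map_smul a, e, map_sub, sub_eq_iff_eq_add] at this
  simp only [sub_apply, mul_apply_eq_comp, this]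
  abel

end Resolvent

/-- A bounded operator commutes with an unbounded one if it preserves its graph. -/
def CommutesWith (D : H →ₗ.[ℂ] H) (B : H →L[ℂ] H) : Prop :=
  ∀ u v, (u, v) ∈ D.graph → (B u, B v) ∈ D.graph

/-! ### Commutation with `D`, and the algebra of the bounded transform. -/

section BoundedTransform

variable {D : H →ₗ.[ℂ] H} {hD : IsSelfAdjoint D}

/-- The graph consists of the pairs `(R x, z R x - x)` with `R` the resolvent, so a single non-real
`z` decides commutation. -/
theorem commutesWith_iff_commute_resolvent {B : H →L[ℂ] H} {z : ℂ} (hz : z.im ≠ 0) :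
    CommutesWith D B ↔ Commute B (resolvent D hD z hz) := by
  constructor
  · intro h
    refine ContinuousLinearMap.ext fun x => ?_
    have := resolvent_apply_of_mem_graph (hD := hD) hz
      (h _ _ (resolvent_mem_graph (hD := hD) hz x))
    rw [map_sub B, map_smul B, sub_sub_cancel] at this
    exact this.symm
  · intro h u v huv
    have hc : ∀ x, B (resolvent D hD z hz x) = resolvent D hD z hz (B x) := fun x =>
      congrArg (fun T : H →L[ℂ] H => T x) h.eq
    have h1 := resolvent_apply_of_mem_graph (hD := hD) hz huv
    have h2 := resolvent_mem_graph (hD := hD) hz (B (z • u - v))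
    rw [← hc, h1, map_sub B, map_smul B, sub_sub_cancel] at h2
    exact h2

theorem invOneAddSq_mem_graph (x : H) :
    ∃ w, (invOneAddSq D hD x, w) ∈ D.graph ∧ (w, x - invOneAddSq D hD x) ∈ D.graph := by
  obtain ⟨h, h', e⟩ := (invOneAddSq_spec D hD).1 x
  exact ⟨_, mem_graph_iff_exists.mpr ⟨h, rfl⟩,
    mem_graph_iff_exists.mpr ⟨h', eq_sub_of_add_eq' e⟩⟩

theorem invOneAddSq_apply_of_mem_graph {u v w : H} (h : (u, v) ∈ D.graph)
    (h' : (v, w) ∈ D.graph) : invOneAddSq D hD (u + w) = u := by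
  obtain ⟨hu, rfl⟩ := mem_graph_iff_exists.mp h
  obtain ⟨hv, rfl⟩ := mem_graph_iff_exists.mp h'
  exact (invOneAddSq_spec D hD).2 ⟨u, hu⟩ hv

theorem boundedTransform_mem_graph (x : H) :
    (CFC.sqrt (invOneAddSq D hD) x, boundedTransform D hD x) ∈ D.graph := by
  obtain ⟨h, e⟩ := boundedTransform_spec D hD x
  exact mem_graph_iff_exists.mpr ⟨h, e.symm⟩

theorem CommutesWith.commute_invOneAddSq {B : H →L[ℂ] H} (h : CommutesWith D B) :
    Commute B (invOneAddSq D hD) := by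
  refine ContinuousLinearMap.ext fun x => ?_
  obtain ⟨w, h1, h2⟩ := invOneAddSq_mem_graph (hD := hD) x
  have := invOneAddSq_apply_of_mem_graph (hD := hD) (h _ _ h1) (h _ _ h2)
  rw [map_sub, add_sub_cancel] at this
  exact this.symm

theorem CommutesWith.commute_sqrt {B : H →L[ℂ] H} (h : CommutesWith D B) :
    Commute B (CFC.sqrt (invOneAddSq D hD)) :=
  (h.commute_invOneAddSq (hD := hD).symm.cfcₙ_nnreal _).symm

theorem CommutesWith.commute_boundedTransform {B : H →L[ℂ] H} (h : CommutesWith D B) :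
    Commute B (boundedTransform D hD) := by
  refine ContinuousLinearMap.ext fun x => ?_
  have h1 := h _ _ (boundedTransform_mem_graph (hD := hD) x)
  have h2 : B (CFC.sqrt (invOneAddSq D hD) x) = CFC.sqrt (invOneAddSq D hD) (B x) :=
    congrArg (fun T : H →L[ℂ] H => T x) (h.commute_sqrt (hD := hD)).eq
  rw [h2] at h1
  exact eq_of_mem_graph h1 (boundedTransform_mem_graph (B x))

/-- The resolvent commutes with itself, hence with `D`, hence with `S`; reading the criterion
backwards, `S` commutes with `D`. -/
theorem commutesWith_sqrt : CommutesWith D (CFC.sqrt (invOneAddSq D hD)) := by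
  have hI : Complex.I.im ≠ 0 := by simp
  rw [commutesWith_iff_commute_resolvent (hD := hD) hI]
  refine (CommutesWith.commute_sqrt ?_).symm
  rw [commutesWith_iff_commute_resolvent (hD := hD) hI]

theorem sqrt_apply_sqrt_apply (x : H) :
    CFC.sqrt (invOneAddSq D hD) (CFC.sqrt (invOneAddSq D hD) x) = invOneAddSq D hD x :=
  congrArg (fun T : H →L[ℂ] H => T x)
    (CFC.sqrt_mul_sqrt_self (invOneAddSq D hD) (invOneAddSq_nonneg D hD))

/-- On the domain `D S = S D`, which replaces the unbounded factor after `S` by the bounded `S`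
after `D`. -/
theorem boundedTransform_apply_of_mem_graph {u v : H} (h : (u, v) ∈ D.graph) :
    boundedTransform D hD u = CFC.sqrt (invOneAddSq D hD) v :=
  eq_of_mem_graph (boundedTransform_mem_graph u) (commutesWith_sqrt _ _ h)

/-- Since `S F x = D S S x = D R x`, one gets `F F x = D S F x = D D R x = x - R x`. -/
theorem boundedTransform_mul_self :
    boundedTransform D hD * boundedTransform D hD = 1 - invOneAddSq D hD := by
  refine ContinuousLinearMap.ext fun x => ?_
  obtain ⟨w, h1, h2⟩ := invOneAddSq_mem_graph (hD := hD) x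
  have h3 : CFC.sqrt (invOneAddSq D hD) (boundedTransform D hD x) = w := by
    have := commutesWith_sqrt (hD := hD) _ _ (boundedTransform_mem_graph (hD := hD) x)
    rw [sqrt_apply_sqrt_apply] at this
    exact eq_of_mem_graph this h1
  have h4 := boundedTransform_mem_graph (hD := hD) (boundedTransform D hD x)
  rw [h3] at h4
  exact eq_of_mem_graph h4 h2

theorem dense_domain (hD : IsSelfAdjoint D) : Dense {u | ∃ v, (u, v) ∈ D.graph} := by
  convert hD.dense_domain using 1
  ext u
  exact ⟨fun ⟨v, h⟩ => (mem_graph_iff_exists.mp h).1,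
    fun h => ⟨_, mem_graph_iff_exists.mpr ⟨h, rfl⟩⟩⟩

/-- For `u` in the domain, `⟪F x, u⟫ = ⟪D S x, u⟫ = ⟪S x, D u⟫ = ⟪x, S D u⟫ = ⟪x, F u⟫`; density
does the rest. -/
theorem isSelfAdjoint_boundedTransform : IsSelfAdjoint (boundedTransform D hD) := by
  have hS : IsSelfAdjoint (CFC.sqrt (invOneAddSq D hD)) := .of_nonneg (CFC.sqrt_nonneg _)
  rw [ContinuousLinearMap.isSelfAdjoint_iff_isSymmetric] at hS ⊢
  intro x y
  refine congrFun (Continuous.ext_on (dense_domain hD)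
    (f := fun y => inner ℂ (boundedTransform D hD x) y)
    (g := fun y => inner ℂ x (boundedTransform D hD y)) (by fun_prop) (by fun_prop) ?_) y
  rintro u ⟨v, h⟩
  have h1 := inner_eq_of_mem_graph hD (boundedTransform_mem_graph (hD := hD) x) h
  simp only [h1]
  rw [boundedTransform_apply_of_mem_graph h]
  exact hS x v

end BoundedTransform

end UnboundedOp

/-! ### The commutator of the bounded transform, as an integral -/

namespace UnboundedOp

open MeasureTheory

/-- Substitute `s = √r t` in the arctangent integral. With `r = (1 + x²)⁻¹` the integrand is `(1 +
t² + x²)⁻¹`. -/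
theorem integral_div_one_add_sq_mul {r : ℝ} (hr : 0 ≤ r) :
    ∫ t : ℝ, r * (1 + t ^ 2 * r)⁻¹ = Real.pi * √r := by
  have h := Measure.integral_comp_mul_left (fun t : ℝ => (1 + t ^ 2)⁻¹) √r
  rw [integral_univ_inv_one_add_sq, abs_of_nonneg (by positivity), smul_eq_mul] at h
  rw [integral_const_mul]
  rcases hr.eq_or_lt with rfl | hr'
  · simp
  · have h2 : ∀ t : ℝ, (1 + t ^ 2 * r)⁻¹ = (1 + (√r * t) ^ 2)⁻¹ := fun t => by
      rw [mul_pow, Real.sq_sqrt hr, mul_comm]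
    simp_rw [h2]
    rw [h]
    have := Real.sq_sqrt hr
    have h3 : √r ≠ 0 := (Real.sqrt_pos.mpr hr').ne'
    field_simp
    linarith

variable {H : Type*} [NormedAddCommGroup H] [InnerProductSpace ℂ H] [CompleteSpace H]

/-- The point `i √(1 + t ^ 2)` of the imaginary axis. -/
noncomputable def imPoint (t : ℝ) : ℂ := (√(1 + t ^ 2) : ℝ) * Complex.I

theorem imPoint_im (t : ℝ) : (imPoint t).im = √(1 + t ^ 2) := by simp [imPoint]

theorem one_le_imPoint_im (t : ℝ) : 1 ≤ (imPoint t).im := by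
  rw [imPoint_im, Real.one_le_sqrt]
  nlinarith [sq_nonneg t]

theorem imPoint_im_ne_zero (t : ℝ) : (imPoint t).im ≠ 0 :=
  (zero_lt_one.trans_le (one_le_imPoint_im t)).ne'

theorem neg_imPoint_im_ne_zero (t : ℝ) : (-imPoint t).im ≠ 0 := by
  rw [Complex.neg_im]
  exact neg_ne_zero.mpr (imPoint_im_ne_zero t)

theorem imPoint_ne_zero (t : ℝ) : imPoint t ≠ 0 := fun h =>
  imPoint_im_ne_zero t (by rw [h, Complex.zero_im])

theorem imPoint_mul_self (t : ℝ) : imPoint t * imPoint t = -((1 + t ^ 2 : ℝ) : ℂ) := by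
  have h : (√(1 + t ^ 2)) * √(1 + t ^ 2) = 1 + t ^ 2 := Real.mul_self_sqrt (by positivity)
  rw [imPoint, mul_mul_mul_comm, Complex.I_mul_I, ← Complex.ofReal_mul, h]
  ring

theorem norm_imPoint (t : ℝ) : ‖imPoint t‖ = √(1 + t ^ 2) := by
  rw [imPoint, norm_mul, Complex.norm_I, mul_one, Complex.norm_real,
    Real.norm_of_nonneg (Real.sqrt_nonneg _)]

theorem continuous_imPoint : Continuous imPoint := by
  unfold imPoint
  fun_prop

/-! ### The family `(1 + t² + D²)⁻¹` by partial fractions, and its integral. -/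

section

variable (D : H →ₗ.[ℂ] H) (hD : IsSelfAdjoint D)

/-- The resolvent at `i √(1 + t ^ 2)`. -/
noncomputable def resPlus (t : ℝ) : H →L[ℂ] H := resolvent D hD (imPoint t) (imPoint_im_ne_zero t)

/-- The resolvent at `-i √(1 + t ^ 2)`. -/
noncomputable def resMinus (t : ℝ) : H →L[ℂ] H :=
  resolvent D hD (-imPoint t) (neg_imPoint_im_ne_zero t)

/-- The operator `(1 + t ^ 2 + D ^ 2)⁻¹`. -/
noncomputable def resSq (t : ℝ) : H →L[ℂ] H :=
  (-(2 * imPoint t)⁻¹) • (resPlus D hD t - resMinus D hD t)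

/-- The operator `D (1 + t ^ 2 + D ^ 2)⁻¹`. -/
noncomputable def resOdd (t : ℝ) : H →L[ℂ] H :=
  (-(2 : ℂ)⁻¹) • (resPlus D hD t + resMinus D hD t)

variable {D hD}

theorem norm_resPlus_le (t : ℝ) : ‖resPlus D hD t‖ ≤ (√(1 + t ^ 2))⁻¹ := by
  refine (norm_resolvent_le _).trans_eq ?_
  rw [imPoint_im, abs_of_nonneg (Real.sqrt_nonneg _)]

theorem norm_resMinus_le (t : ℝ) : ‖resMinus D hD t‖ ≤ (√(1 + t ^ 2))⁻¹ := by
  refine (norm_resolvent_le _).trans_eq ?_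
  rw [Complex.neg_im, abs_neg, imPoint_im, abs_of_nonneg (Real.sqrt_nonneg _)]

theorem norm_resolvent_sub_resolvent_le {z w : ℂ} (hz : 1 ≤ |z.im|) (hw : 1 ≤ |w.im|)
    (hz' : z.im ≠ 0) (hw' : w.im ≠ 0) :
    ‖resolvent D hD z hz' - resolvent D hD w hw'‖ ≤ ‖z - w‖ := by
  rw [resolvent_sub_resolvent, norm_smul, norm_sub_rev]
  refine mul_le_of_le_one_right (norm_nonneg _) ((norm_mul_le _ _).trans ?_)
  exact mul_le_one₀ ((norm_resolvent_le _).trans (inv_le_one_of_one_le₀ hz)) (norm_nonneg _)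
    ((norm_resolvent_le _).trans (inv_le_one_of_one_le₀ hw))

theorem one_le_abs_imPoint_im (t : ℝ) : 1 ≤ |(imPoint t).im| :=
  (one_le_imPoint_im t).trans (le_abs_self _)

theorem continuous_resPlus : Continuous (resPlus D hD) := by
  rw [continuous_iff_continuousAt]
  intro t
  rw [ContinuousAt, tendsto_iff_norm_sub_tendsto_zero]
  have h := tendsto_iff_norm_sub_tendsto_zero.mp (continuous_imPoint.tendsto t)
  exact squeeze_zero (fun _ => norm_nonneg _) (fun s => norm_resolvent_sub_resolvent_le
    (one_le_abs_imPoint_im s) (one_le_abs_imPoint_im t) _ _) h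

theorem continuous_resMinus : Continuous (resMinus D hD) := by
  rw [continuous_iff_continuousAt]
  intro t
  rw [ContinuousAt, tendsto_iff_norm_sub_tendsto_zero]
  have h := tendsto_iff_norm_sub_tendsto_zero.mp (continuous_imPoint.neg.tendsto t)
  refine squeeze_zero (fun _ => norm_nonneg _) (fun s => norm_resolvent_sub_resolvent_le
    ?_ ?_ _ _) h <;> rw [Complex.neg_im, abs_neg] <;> exact one_le_abs_imPoint_im _

theorem continuous_resSq : Continuous (resSq D hD) := by
  unfold resSq
  have h : Continuous fun t => (2 * imPoint t)⁻¹ := (continuous_imPoint.const_mul 2).inv₀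
    fun t => mul_ne_zero two_ne_zero (imPoint_ne_zero t)
  exact h.neg.smul (continuous_resPlus (D := D) (hD := hD).sub continuous_resMinus)

theorem continuous_resOdd : Continuous (resOdd D hD) := by
  unfold resOdd
  exact (continuous_resPlus (D := D) (hD := hD).add continuous_resMinus).const_smul (-(2 : ℂ)⁻¹)

theorem inv_sqrt_mul_inv_sqrt (t : ℝ) : (√(1 + t ^ 2))⁻¹ * (√(1 + t ^ 2))⁻¹ = (1 + t ^ 2)⁻¹ := by
  rw [← mul_inv, Real.mul_self_sqrt (by positivity)]

theorem norm_resSq_le (t : ℝ) : ‖resSq D hD t‖ ≤ (1 + t ^ 2)⁻¹ := by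
  rw [resSq, norm_smul, norm_neg, norm_inv, norm_mul, norm_imPoint, mul_inv, Complex.norm_ofNat]
  have h1 := norm_resPlus_le (D := D) (hD := hD) t
  have h2 := norm_resMinus_le (D := D) (hD := hD) t
  have h3 : ‖resPlus D hD t - resMinus D hD t‖ ≤ 2 * (√(1 + t ^ 2))⁻¹ :=
    (norm_sub_le _ _).trans (by linarith)
  calc _ ≤ 2⁻¹ * (√(1 + t ^ 2))⁻¹ * (2 * (√(1 + t ^ 2))⁻¹) := by gcongr
    _ = (1 + t ^ 2)⁻¹ := by rw [← inv_sqrt_mul_inv_sqrt]; ring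

theorem resOdd_apply_of_mem_graph (t : ℝ) {u v : H} (h : (u, v) ∈ D.graph) :
    resOdd D hD t u = resSq D hD t v := by
  have h1 : resPlus D hD t v = imPoint t • resPlus D hD t u - u := resolvent_apply_snd _ h
  have h2 : resMinus D hD t v = -imPoint t • resMinus D hD t u - u := resolvent_apply_snd _ h
  simp only [resOdd, resSq, smul_apply, sub_apply, add_apply, h1, h2]
  have := imPoint_ne_zero t
  match_scalars <;> field_simp
  ring

theorem resOdd_apply_snd (t : ℝ) {u v : H} (h : (u, v) ∈ D.graph) :
    resOdd D hD t v = u - ((1 + t ^ 2 : ℝ) : ℂ) • resSq D hD t u := by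
  have h1 : resPlus D hD t v = imPoint t • resPlus D hD t u - u := resolvent_apply_snd _ h
  have h2 : resMinus D hD t v = -imPoint t • resMinus D hD t u - u := resolvent_apply_snd _ h
  rw [← neg_neg ((1 + t ^ 2 : ℝ) : ℂ), ← imPoint_mul_self]
  simp only [resOdd, resSq, smul_apply, sub_apply, add_apply, h1, h2]
  have := imPoint_ne_zero t
  match_scalars <;> field_simp
  norm_num

/-- Evaluate `resOdd` at `w = D R x` in two ways, from `w = D (R x)` and from `D w = x - R x`. The
identity makes `resSq` a function of the bounded operator `R`. -/
theorem resSq_mul (t : ℝ) :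
    resSq D hD t * (1 + (t ^ 2) • invOneAddSq D hD) = invOneAddSq D hD := by
  refine ContinuousLinearMap.ext fun x => ?_
  obtain ⟨w, h1, h2⟩ := invOneAddSq_mem_graph (hD := hD) x
  have h3 := resOdd_apply_of_mem_graph (hD := hD) t h2
  rw [resOdd_apply_snd t h1, map_sub, Complex.coe_smul, add_smul, one_smul] at h3
  have h4 : resSq D hD t (x + t ^ 2 • invOneAddSq D hD x) = invOneAddSq D hD x := by
    rw [map_add, ContinuousLinearMap.map_smul_of_tower]
    have e : ∀ p q r s : H, p - q = r - (q + s) → p + s = r := fun p q r s h => by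
      have := congrArg (· + (q + s)) h
      simp only [sub_add_cancel] at this
      rw [← this]; abel
    exact e _ _ _ _ h3.symm
  exact h4

theorem resSq_zero : resSq D hD 0 = invOneAddSq D hD := by
  simpa using resSq_mul (D := D) (hD := hD) 0

theorem norm_invOneAddSq_le : ‖invOneAddSq D hD‖ ≤ 1 := by
  simpa [resSq_zero] using norm_resSq_le (D := D) (hD := hD) 0

theorem spectrum_invOneAddSq {r : ℝ} (hr : r ∈ spectrum ℝ (invOneAddSq D hD)) :
    0 ≤ r ∧ r ≤ 1 := by
  refine ⟨spectrum_nonneg_of_nonneg (invOneAddSq_nonneg D hD) hr, ?_⟩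
  -- Bounding the spectrum by the norm uses `‖1‖ = 1`, which fails on the zero space.
  rcases subsingleton_or_nontrivial H with h | h
  · rw [spectrum.of_subsingleton] at hr
    exact hr.elim
  have := spectrum.norm_le_norm_of_mem hr
  exact (le_abs_self r).trans (this.trans norm_invOneAddSq_le)

/-- As `R ≥ 0`, the factor `1 + t² R` in `resSq_mul` is invertible by functional calculus and can be
divided out. -/
theorem resSq_eq_cfc (t : ℝ) :
    resSq D hD t = cfc (fun r : ℝ => r * (1 + t ^ 2 * r)⁻¹) (invOneAddSq D hD) := by
  set R := invOneAddSq D hD with hR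
  have hsa : IsSelfAdjoint R := .of_nonneg (invOneAddSq_nonneg D hD)
  have hne : ∀ r ∈ spectrum ℝ R, 1 + t ^ 2 * r ≠ 0 := fun r hr => by
    have := (spectrum_invOneAddSq hr).1
    positivity
  have h1 : (1 : H →L[ℂ] H) + t ^ 2 • R = cfc (fun r : ℝ => 1 + t ^ 2 * r) R := by
    rw [cfc_add R (fun _ : ℝ => (1 : ℝ)) (fun r => t ^ 2 * r), cfc_const_one ℝ R,
      cfc_const_mul_id (t ^ 2) R]
  have hc : ContinuousOn (fun r : ℝ => (1 + t ^ 2 * r)⁻¹) (spectrum ℝ R) :=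
    ContinuousOn.inv₀ (by fun_prop) hne
  have h2 : ((1 : H →L[ℂ] H) + t ^ 2 • R) * cfc (fun r : ℝ => (1 + t ^ 2 * r)⁻¹) R = 1 := by
    rw [h1, ← cfc_mul _ _ R (by fun_prop) hc]
    rw [cfc_congr (g := fun _ => (1 : ℝ)) fun r hr => mul_inv_cancel₀ (hne r hr),
      cfc_const_one ℝ R]
  rw [cfc_mul (fun r : ℝ => r) _ R (by fun_prop) hc, cfc_id' ℝ R]
  nth_rewrite 1 [hR]
  rw [← resSq_mul t, ← hR, mul_assoc, h2, mul_one]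

theorem integrable_of_norm_le {E : Type*} [NormedAddCommGroup E] {f : ℝ → E} (hf : Continuous f)
    (C : ℝ) (h : ∀ t, ‖f t‖ ≤ C * (1 + t ^ 2)⁻¹) : Integrable f :=
  (integrable_inv_one_add_sq.const_mul C).mono' hf.aestronglyMeasurable
    (.of_forall h)

theorem integrable_resSq : Integrable (resSq D hD) :=
  integrable_of_norm_le continuous_resSq 1 fun t => by
    rw [one_mul]
    exact norm_resSq_le t

theorem integral_resSq :
    ∫ t, resSq D hD t = Real.pi • CFC.sqrt (invOneAddSq D hD) := by
  have h0 := invOneAddSq_nonneg D hD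
  have hsa : IsSelfAdjoint (invOneAddSq D hD) := .of_nonneg h0
  simp_rw [resSq_eq_cfc]
  rw [← cfc_integral (fun (t : ℝ) (r : ℝ) => r * (1 + t ^ 2 * r)⁻¹)
    (fun t => (1 + t ^ 2)⁻¹) (invOneAddSq D hD)]
  · rw [cfc_congr (g := fun r => Real.pi * √r) fun r hr =>
      integral_div_one_add_sq_mul (spectrum_invOneAddSq hr).1, cfc_const_mul _ _ _ ,
      CFC.sqrt_eq_real_sqrt _ h0, cfcₙ_eq_cfc]
  · refine ContinuousOn.mul (by fun_prop) (ContinuousOn.inv₀ (by fun_prop) ?_)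
    rintro ⟨t, r⟩ ⟨-, hr⟩
    have := (spectrum_invOneAddSq hr).1
    simp only
    positivity
  -- Domination: `r (1 + t²) ≤ 1 + t² r` because `r ≤ 1` on the spectrum.
  · refine .of_forall fun t r hr => ?_
    obtain ⟨h1, h2⟩ := spectrum_invOneAddSq hr
    rw [Real.norm_of_nonneg (by positivity), ← div_eq_mul_inv, ← one_div,
      div_le_div_iff₀ (by positivity) (by positivity)]
    nlinarith
  · exact integrable_inv_one_add_sq.2

/-! ### The commutator of `F` as a norm convergent integral. -/

theorem resPlus_commutator (t : ℝ) {a T : H →L[ℂ] H}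
    (ha : ∀ u v, (u, v) ∈ D.graph → (a u, T u + a v) ∈ D.graph) :
    resPlus D hD t * a - a * resPlus D hD t = resPlus D hD t * T * resPlus D hD t :=
  resolvent_commutator _ ha

theorem resMinus_commutator (t : ℝ) {a T : H →L[ℂ] H}
    (ha : ∀ u v, (u, v) ∈ D.graph → (a u, T u + a v) ∈ D.graph) :
    resMinus D hD t * a - a * resMinus D hD t = resMinus D hD t * T * resMinus D hD t :=
  resolvent_commutator _ ha

theorem norm_mul_mul_le_of_norm_le {P T : H →L[ℂ] H} {t : ℝ} (h : ‖P‖ ≤ (√(1 + t ^ 2))⁻¹) :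
    ‖P * T * P‖ ≤ ‖T‖ * (1 + t ^ 2)⁻¹ := by
  calc ‖P * T * P‖ ≤ ‖P‖ * ‖T‖ * ‖P‖ :=
        (norm_mul_le _ _).trans (mul_le_mul_of_nonneg_right (norm_mul_le _ _) (norm_nonneg _))
    _ ≤ (√(1 + t ^ 2))⁻¹ * ‖T‖ * (√(1 + t ^ 2))⁻¹ := by gcongr
    _ = ‖T‖ * (1 + t ^ 2)⁻¹ := by rw [← inv_sqrt_mul_inv_sqrt]; ring

/-- Each resolvent commutator has a resolvent on both sides of `T`, hence two factors `(1 +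
t²)^(-1/2)`; one alone would not be integrable. -/
theorem norm_resOdd_commutator_le (t : ℝ) {a T : H →L[ℂ] H}
    (ha : ∀ u v, (u, v) ∈ D.graph → (a u, T u + a v) ∈ D.graph) :
    ‖resOdd D hD t * a - a * resOdd D hD t‖ ≤ ‖T‖ * (1 + t ^ 2)⁻¹ := by
  have h : resOdd D hD t * a - a * resOdd D hD t =
      (-(2 : ℂ)⁻¹) • (resPlus D hD t * T * resPlus D hD t +
        resMinus D hD t * T * resMinus D hD t) := by
    rw [← resPlus_commutator t ha, ← resMinus_commutator t ha, resOdd, smul_mul_assoc,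
      mul_smul_comm, ← smul_sub, add_mul, mul_add, add_sub_add_comm]
  rw [h, norm_smul, norm_neg, norm_inv, Complex.norm_ofNat]
  have h1 := norm_mul_mul_le_of_norm_le (T := T) (norm_resPlus_le (D := D) (hD := hD) t)
  have h2 := norm_mul_mul_le_of_norm_le (T := T) (norm_resMinus_le (D := D) (hD := hD) t)
  linarith [norm_add_le (resPlus D hD t * T * resPlus D hD t)
    (resMinus D hD t * T * resMinus D hD t)]

theorem continuous_resOdd_commutator (a : H →L[ℂ] H) :
    Continuous fun t => resOdd D hD t * a - a * resOdd D hD t :=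
  (continuous_resOdd.mul continuous_const).sub (continuous_const.mul continuous_resOdd)

theorem integrable_resOdd_commutator {a T : H →L[ℂ] H}
    (ha : ∀ u v, (u, v) ∈ D.graph → (a u, T u + a v) ∈ D.graph) :
    Integrable fun t => resOdd D hD t * a - a * resOdd D hD t :=
  integrable_of_norm_le (continuous_resOdd_commutator a) ‖T‖ fun t =>
    norm_resOdd_commutator_le t ha

theorem integral_resSq_apply (w : H) :
    ∫ t, resSq D hD t w = Real.pi • CFC.sqrt (invOneAddSq D hD) w := by
  rw [← ContinuousLinearMap.integral_apply integrable_resSq, integral_resSq]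
  rfl

theorem integral_resOdd_commutator {a T : H →L[ℂ] H}
    (ha : ∀ u v, (u, v) ∈ D.graph → (a u, T u + a v) ∈ D.graph) :
    ∫ t, (resOdd D hD t * a - a * resOdd D hD t) =
      Real.pi • (boundedTransform D hD * a - a * boundedTransform D hD) := by
  refine ContinuousLinearMap.ext fun x => congrFun (Continuous.ext_on (dense_domain hD)
    (ContinuousLinearMap.continuous _) (ContinuousLinearMap.continuous _) ?_) x
  rintro u ⟨v, h⟩
  have hint : ∀ w, Integrable fun t => resSq D hD t w := fun w =>
    integrable_resSq.apply_continuousLinearMap w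
  rw [ContinuousLinearMap.integral_apply (integrable_resOdd_commutator ha)]
  -- On domain vectors `resOdd` turns into the integrable `resSq`, so the two halves of the
  -- commutator can be integrated separately.
  have h1 : ∀ t, (resOdd D hD t * a - a * resOdd D hD t) u =
      resSq D hD t (T u + a v) - a (resSq D hD t v) := fun t => by
    rw [← resOdd_apply_of_mem_graph t (ha u v h), ← resOdd_apply_of_mem_graph t h]
    rfl
  simp_rw [h1]
  rw [integral_sub (hint _) (a.integrable_comp (hint v)), a.integral_comp_comm (hint v),
    integral_resSq_apply, integral_resSq_apply, ContinuousLinearMap.map_smul_of_tower, ← smul_sub,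
    ← boundedTransform_apply_of_mem_graph (ha u v h), ← boundedTransform_apply_of_mem_graph h]
  rfl

/-- A closed subspace is itself a Banach space: integrate there, then apply the inclusion. -/
theorem integral_mem_of_isClosed {E : Type*} [NormedAddCommGroup E] [NormedSpace ℂ E]
    [CompleteSpace E] (K : Submodule ℂ E) (hK : IsClosed (K : Set E)) {f : ℝ → E}
    (hf : Continuous f) (hi : Integrable f) (h : ∀ t, f t ∈ K) : ∫ t, f t ∈ K := by
  have : CompleteSpace K := hK.completeSpace_coe
  have hc : Continuous fun t => (⟨f t, h t⟩ : K) := hf.subtype_mk h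
  have hi' : Integrable fun t => (⟨f t, h t⟩ : K) := hi.mono hc.aestronglyMeasurable
    (.of_forall fun t => le_rfl)
  have := K.subtypeL.integral_comp_comm hi'
  change ∫ t, f t = _ at this
  rw [this]
  exact Submodule.coe_mem _

/-- The commutator of `a` with the bounded transform of `D` lies in any closed subspace that
contains the commutators of `a` with the resolvents of `D`. -/
theorem boundedTransform_commutator_mem {a T : H →L[ℂ] H}
    (ha : ∀ u v, (u, v) ∈ D.graph → (a u, T u + a v) ∈ D.graph)
    (K : Submodule ℂ (H →L[ℂ] H)) (hK : IsClosed (K : Set (H →L[ℂ] H)))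
    (h : ∀ (z : ℂ) (hz : z.im ≠ 0), resolvent D hD z hz * a - a * resolvent D hD z hz ∈ K) :
    boundedTransform D hD * a - a * boundedTransform D hD ∈ K := by
  have h1 : ∫ t, (resOdd D hD t * a - a * resOdd D hD t) ∈ K := by
    refine integral_mem_of_isClosed K hK (continuous_resOdd_commutator a)
      (integrable_resOdd_commutator ha) fun t => ?_
    rw [resOdd, smul_mul_assoc, mul_smul_comm, ← smul_sub, add_mul, mul_add, add_sub_add_comm]
    exact K.smul_mem _ (K.add_mem (h _ _) (h _ _))
  rw [integral_resOdd_commutator ha] at h1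
  have h2 := K.smul_mem (((Real.pi)⁻¹ : ℝ) : ℂ) h1
  rwa [Complex.coe_smul, smul_smul, inv_mul_cancel₀ Real.pi_ne_zero, one_smul] at h2

end

end UnboundedOp

/-! ### Membership in a von Neumann algebra -/

namespace VonNeumannAlgebra

variable {H : Type*} [NormedAddCommGroup H] [InnerProductSpace ℂ H] [CompleteSpace H]

/-- An operator that commutes with the unitaries of the commutant of `N` is in `N`. -/
theorem mem_of_commute_unitary {N : VonNeumannAlgebra H} {x : H →L[ℂ] H}
    (h : ∀ u ∈ unitary (H →L[ℂ] H), u ∈ N.commutant → Commute u x) : x ∈ N := by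
  rw [← N.commutant_commutant, mem_commutant_iff]
  intro g hg
  -- Closedness makes the commutant a C*-algebra, hence the span of its unitaries; commuting with
  -- `x` is a linear condition.
  have : IsClosed (N.commutant : Set (H →L[ℂ] H)) := ClosedIdeal.isClosed_vN _
  have hspan := CStarAlgebra.span_unitary (A := N.commutant)
  have hmem : (⟨g, hg⟩ : N.commutant) ∈
      Submodule.span ℂ (unitary N.commutant : Set N.commutant) := by
    rw [hspan]
    trivial
  suffices H : ∀ y : N.commutant, y ∈ Submodule.span ℂ (unitary N.commutant : Set N.commutant) →
      Commute (y : H →L[ℂ] H) x from H _ hmem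
  intro y hy
  induction hy using Submodule.span_induction with
  | mem u hu =>
    refine h u ?_ u.2
    rw [SetLike.mem_coe, Unitary.mem_iff] at hu
    rw [Unitary.mem_iff]
    exact ⟨congrArg Subtype.val hu.1, congrArg Subtype.val hu.2⟩
  | zero => exact Commute.zero_left x
  | add u v _ _ hu hv => exact hu.add_left hv
  | smul c u _ hu => exact hu.smul_left c

end VonNeumannAlgebra

namespace ClosedIdeal

variable {H : Type*} [NormedAddCommGroup H] [InnerProductSpace ℂ H] [CompleteSpace H]
  {N : VonNeumannAlgebra H} (J : ClosedIdeal N)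

/-- A closed ideal, as a subspace of the bounded operators. -/
def toSubmodule : Submodule ℂ (H →L[ℂ] H) := J.alg.toNonUnitalSubalgebra.toSubmodule

theorem isClosed_toSubmodule : IsClosed (J.toSubmodule : Set (H →L[ℂ] H)) := J.isClosed_alg

end ClosedIdeal

/-! ### The bounded transform of a von Neumann spectral triple -/

namespace VNSpectralTriple

open UnboundedOp

variable {H : Type*} [NormedAddCommGroup H] [InnerProductSpace ℂ H] [CompleteSpace H]
  {N : VonNeumannAlgebra H} {J : ClosedIdeal N} {𝒜 : Type*}
  [NonUnitalRing 𝒜] [StarRing 𝒜] [Module ℂ 𝒜] (t : VNSpectralTriple N J 𝒜)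

theorem commutesWith_of_mem_commutant {u : H →L[ℂ] H} (hu : u ∈ unitary (H →L[ℂ] H))
    (hu' : u ∈ N.commutant) : CommutesWith t.D u := by
  intro x y h
  obtain ⟨hx, rfl⟩ := mem_graph_iff_exists.mp h
  exact mem_graph_iff_exists.mpr (t.affiliated u hu hu' ⟨x, hx⟩)

theorem F_mem : t.F ∈ N := VonNeumannAlgebra.mem_of_commute_unitary fun _ hu hu' =>
  (t.commutesWith_of_mem_commutant hu hu').commute_boundedTransform

theorem isSelfAdjoint_F : IsSelfAdjoint t.F := isSelfAdjoint_boundedTransform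

theorem exists_commutator (a : 𝒜) : ∃ T : H →L[ℂ] H, ∀ u v, (u, v) ∈ t.D.graph →
    (t.rep a u, T u + t.rep a v) ∈ t.D.graph := by
  obtain ⟨h, T, hT⟩ := t.commutator_bounded a
  refine ⟨T, fun u v huv => ?_⟩
  obtain ⟨hu, rfl⟩ := mem_graph_iff_exists.mp huv
  refine mem_graph_iff_exists.mpr ⟨h u hu, ?_⟩
  rw [hT ⟨u, hu⟩, sub_add_cancel]

/-- This is the adjoint of `a* (z̄ - D)⁻¹`, and closed ideals are self-adjoint. -/
theorem resolvent_mul_mem (z : ℂ) (hz : z.im ≠ 0) (a : 𝒜) :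
    resolvent t.D t.selfAdjoint z hz * t.rep a ∈ J.alg := by
  have hz' : (starRingEnd ℂ z).im ≠ 0 := by rwa [Complex.conj_im, neg_ne_zero]
  have h := star_mem (t.resolvent_mem _ hz' (star a))
  rw [← star_resolvent hz hz', star_mul, star_star, map_star, star_star] at h
  exact h

theorem commutator_rep_mem (a : 𝒜) : t.F * t.rep a - t.rep a * t.F ∈ J.alg := by
  obtain ⟨T, hT⟩ := t.exists_commutator a
  exact boundedTransform_commutator_mem hT J.toSubmodule J.isClosed_toSubmodule fun z hz =>
    sub_mem (t.resolvent_mul_mem z hz a) (t.resolvent_mem z hz a)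

/-- `1 - F² = (1 + D²)⁻¹` is the case `t = 0` of `resSq`, a multiple of the difference of the
resolvents at `±i`. -/
theorem rep_mul_one_sub_mem (a : 𝒜) : t.rep a * (1 - t.F * t.F) ∈ J.alg := by
  rw [F, boundedTransform_mul_self, sub_sub_cancel, ← resSq_zero, resSq, mul_smul_comm, mul_sub]
  exact SMulMemClass.smul_mem _ (sub_mem (t.resolvent_mem _ _ a) (t.resolvent_mem _ _ a))

theorem forall_mem_A {p : (H →L[ℂ] H) → (H →L[ℂ] H)} (hp : Continuous p)
    (h : ∀ a, p (t.rep a) ∈ J.alg) : ∀ a ∈ t.A, p a ∈ J.alg := by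
  intro a ha
  refine closure_minimal (t := p ⁻¹' (J.alg : Set (H →L[ℂ] H))) ?_ (J.isClosed_alg.preimage hp) ha
  rintro _ ⟨b, rfl⟩
  exact h b

theorem commutator_mem {a : H →L[ℂ] H} (ha : a ∈ t.A) : t.F * a - a * t.F ∈ J.alg :=
  t.forall_mem_A (p := fun a => t.F * a - a * t.F) (by fun_prop) t.commutator_rep_mem a ha

theorem mul_one_sub_mem {a : H →L[ℂ] H} (ha : a ∈ t.A) : a * (1 - t.F * t.F) ∈ J.alg :=
  t.forall_mem_A (p := fun a => a * (1 - t.F * t.F)) (by fun_prop) t.rep_mul_one_sub_mem a ha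

end VNSpectralTriple

/-! ### A σ-unital C*-algebra as a Hilbert module over itself -/

theorem IsSigmaUnital.prod {B : Type*} [NonUnitalCStarAlgebra B] (h : IsSigmaUnital B) :
    IsSigmaUnital (B × B) := by
  obtain ⟨e, he⟩ := h
  refine ⟨fun n => (e n, e n), ⟨fun m => ?_, fun m => ?_⟩⟩
  · exact (((he.tendsto_mul_left m.1).comp Filter.tendsto_map).prodMk_nhds
      ((he.tendsto_mul_left m.2).comp Filter.tendsto_map))
  · exact (((he.tendsto_mul_right m.1).comp Filter.tendsto_map).prodMk_nhds
      ((he.tendsto_mul_right m.2).comp Filter.tendsto_map))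

/-! ### Countable generation and compactness from an approximate unit. -/

namespace HilbertModule

variable {B : Type*} [NonUnitalCStarAlgebra B]

theorem isCountablyGenerated_self (h : IsSigmaUnital B) : IsCountablyGenerated B B := by
  obtain ⟨e, he⟩ := h
  refine ⟨Set.range e, Set.countable_range e, fun b => ?_⟩
  have hlim : Filter.Tendsto (fun n => e n * b) Filter.atTop (nhds b) :=
    (he.tendsto_mul_right b).comp Filter.tendsto_map
  exact mem_closure_of_tendsto hlim (.of_forall fun n =>
    Submodule.subset_span ⟨e n, ⟨n, rfl⟩, b, rfl⟩)

/-- Left multiplication by an element of a σ-unital C*-algebra is compact. -/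
theorem mem_compacts_self (h : IsSigmaUnital B) {T : B →L[ℂ] B} (c : B) (hT : ∀ x, T x = c * x) :
    T ∈ compacts B B := by
  obtain ⟨e, he⟩ := h
  have hTc : T = ContinuousLinearMap.mul ℂ B c := ContinuousLinearMap.ext hT
  have hlim : Filter.Tendsto (fun n => ContinuousLinearMap.mul ℂ B (c * e n)) Filter.atTop
      (nhds T) := by
    rw [hTc]
    exact ((ContinuousLinearMap.mul ℂ B).continuous.tendsto c).comp
      ((he.tendsto_mul_left c).comp Filter.tendsto_map)
  -- Multiplication by `c eₙ` is the rank one operator `z ↦ c · ⟪eₙ*, z⟫`, and `c eₙ → c`.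
  refine mem_closure_of_tendsto hlim (.of_forall fun n => Submodule.subset_span
    ⟨c, star (e n), fun z => ?_⟩)
  change c * e n * z = c * (star (star (e n)) * z)
  rw [star_star, mul_assoc]

end HilbertModule

/-! ### The ungraded and the graded Kasparov module. -/

open HilbertModule in
theorem VNSpectralTriple.isKasparovModule {H : Type*} [NormedAddCommGroup H]
    [InnerProductSpace ℂ H] [CompleteSpace H] {N : VonNeumannAlgebra H} {J : ClosedIdeal N}
    {𝒜 : Type*} [NonUnitalRing 𝒜] [StarRing 𝒜] [Module ℂ 𝒜] (t : VNSpectralTriple N J 𝒜)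
    (hJ : IsSigmaUnital J.alg) :
    IsKasparovModule J.alg (J.leftMulHom t.A t.mem_of_mem_A) (J.leftMul t.F t.F_mem) where
  countablyGenerated := isCountablyGenerated_self hJ
  star_hom a x y := Subtype.ext <| by
    change star ((a : H →L[ℂ] H) * x) * (y : H →L[ℂ] H) = star (x : H →L[ℂ] H) * (star (a : H →L[ℂ] H) * y)
    rw [star_mul, mul_assoc]
  sq_sub_one a := by
    refine mem_compacts_self hJ (-⟨_, t.mul_one_sub_mem a.2⟩) fun x => Subtype.ext ?_
    change (a : H →L[ℂ] H) * (t.F * (t.F * x) - x) = -(a * (1 - t.F * t.F)) * x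
    noncomm_ring
  sub_adjoint := by
    refine ⟨J.leftMul t.F t.F_mem, fun x y => Subtype.ext ?_, fun a => ?_⟩
    · change star (t.F * (x : H →L[ℂ] H)) * (y : H →L[ℂ] H) = star (x : H →L[ℂ] H) * (t.F * y)
      rw [star_mul, t.isSelfAdjoint_F.star_eq, mul_assoc]
    · rw [sub_self, mul_zero]
      exact zero_mem _
  commutator a := by
    refine mem_compacts_self hJ ⟨_, t.commutator_mem a.2⟩ fun x => Subtype.ext ?_
    change t.F * ((a : H →L[ℂ] H) * x) - a * (t.F * x) = (t.F * a - a * t.F) * x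
    noncomm_ring

open HilbertModule in
theorem VNSpectralTriple.isGradedKasparovModule {H : Type*} [NormedAddCommGroup H]
    [InnerProductSpace ℂ H] [CompleteSpace H] {N : VonNeumannAlgebra H} {J : ClosedIdeal N}
    {𝒜 : Type*} [NonUnitalRing 𝒜] [StarRing 𝒜] [Module ℂ 𝒜] (t : VNSpectralTriple N J 𝒜)
    (hJ : IsSigmaUnital J.alg) :
    IsGradedKasparovModule (J.alg × J.alg)
      (NonUnitalStarAlgHom.id ℂ t.A) (HilbertModule.flip J.alg) (flipL J.alg)
      (tensorOne (J.leftMulHom t.A t.mem_of_mem_A)) (tensorEps (J.leftMul t.F t.F_mem)) where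
  grading_left _ := rfl
  grading_right _ := rfl
  grading_module _ := rfl
  grading_act _ _ := rfl
  grading_ip _ _ := rfl
  countablyGenerated := isCountablyGenerated_self hJ.prod
  star_hom a x y := Prod.ext (t.isKasparovModule hJ |>.star_hom a x.1 y.1)
    (t.isKasparovModule hJ |>.star_hom a x.2 y.2)
  graded_hom _ _ := rfl
  odd x := Prod.ext rfl (neg_neg _).symm
  sq_sub_one a := by
    -- As `ε² = 1`, both summands carry the same element.
    refine mem_compacts_self hJ.prod
      (-⟨_, t.mul_one_sub_mem a.2⟩, -⟨_, t.mul_one_sub_mem a.2⟩) fun x =>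
      Prod.ext (Subtype.ext ?_) (Subtype.ext ?_)
    · change (a : H →L[ℂ] H) * (t.F * (t.F * x.1) - x.1) = -(a * (1 - t.F * t.F)) * x.1
      noncomm_ring
    · change (a : H →L[ℂ] H) * (-(t.F * (-(t.F * x.2) : H →L[ℂ] H)) - x.2) =
        -(a * (1 - t.F * t.F)) * x.2
      noncomm_ring
  sub_adjoint := by
    refine ⟨tensorEps (J.leftMul t.F t.F_mem), fun x y =>
      Prod.ext (Subtype.ext ?_) (Subtype.ext ?_), fun a => ?_⟩
    · change star (t.F * (x.1 : H →L[ℂ] H)) * (y.1 : H →L[ℂ] H) =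
        star (x.1 : H →L[ℂ] H) * (t.F * y.1)
      rw [star_mul, t.isSelfAdjoint_F.star_eq, mul_assoc]
    · change star (-(t.F * (x.2 : H →L[ℂ] H))) * (y.2 : H →L[ℂ] H) =
        star (x.2 : H →L[ℂ] H) * -(t.F * (y.2 : H →L[ℂ] H))
      rw [star_neg, star_mul, t.isSelfAdjoint_F.star_eq]
      noncomm_ring
    · rw [sub_self, mul_zero]
      exact zero_mem _
  commutator a := by
    -- `A` is trivially graded, so the graded commutator is the ordinary one; `ε` enters once and
    -- flips the sign on the second summand.
    refine mem_compacts_self hJ.prod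
      (⟨_, t.commutator_mem a.2⟩, -⟨_, t.commutator_mem a.2⟩) fun x =>
      Prod.ext (Subtype.ext ?_) (Subtype.ext ?_)
    · change t.F * ((a : H →L[ℂ] H) * x.1) - a * (t.F * x.1) = (t.F * a - a * t.F) * x.1
      noncomm_ring
    · change -(t.F * ((a : H →L[ℂ] H) * x.2)) - a * -(t.F * (x.2 : H →L[ℂ] H)) =
        -(t.F * a - a * t.F) * x.2
      noncomm_ring

theorem mainTheorem4 {H : Type*} [NormedAddCommGroup H] [InnerProductSpace ℂ H] [CompleteSpace H]
    (N : VonNeumannAlgebra H) (J : ClosedIdeal N)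
    {𝒜 : Type*} [NonUnitalRing 𝒜] [StarRing 𝒜] [Module ℂ 𝒜] [IsScalarTower ℂ 𝒜 𝒜]
    [SMulCommClass ℂ 𝒜 𝒜] [StarModule ℂ 𝒜] (t : VNSpectralTriple N J 𝒜) :
    (∀ a ∈ t.A, t.F * a - a * t.F ∈ J.alg ∧ a * (1 - t.F * t.F) ∈ J.alg ∧
      a * (t.F - star t.F) ∈ J.alg) ∧
    ∃ hF : t.F ∈ N, IsSigmaUnital J.alg →
      HilbertModule.IsKasparovModule J.alg
        (J.leftMulHom t.A t.mem_of_mem_A) (J.leftMul t.F hF) ∧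
      HilbertModule.IsGradedKasparovModule (J.alg × J.alg)
        (NonUnitalStarAlgHom.id ℂ t.A) (HilbertModule.flip J.alg) (HilbertModule.flipL J.alg)
        (HilbertModule.tensorOne (J.leftMulHom t.A t.mem_of_mem_A))
        (HilbertModule.tensorEps (J.leftMul t.F hF)) := by
  refine ⟨fun a ha => ⟨t.commutator_mem ha, t.mul_one_sub_mem ha, ?_⟩, t.F_mem, fun hJ =>
    ⟨t.isKasparovModule hJ, t.isGradedKasparovModule hJ⟩⟩
  rw [t.isSelfAdjoint_F.star_eq, sub_self, mul_zero]
  exact zero_mem _
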